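/- Fix an integer $a\ge 0$ and a real $c>0$. Then there is a constant $C=C(a,c)>0$ such that the following holds for all integers $n\ge 2$ and $0\le m,M\le n^a$. A turnstile stream is a sequence of at most $m$ updates $(i_t,\Delta_t)$ with $i_t\in[n]$ and $\Delta_t\in\{-M,\dots,M\}$; it defines the vector $x\in\mathbb Z^n$, $x_i=\sum_{t:\,i_t=i}\Delta_t$. A streaming algorithm is a one-pass randomized algorithm (a finite state space, a random initial state, a random transition for each update, and a random output computed from the final state); its space in bits is $\lceil\log_2 S\rceil$, where $S$ is its number of states. For $G:\mathbb R\to[0,\infty)$, a perfect $G$-sample from $x$ with failure probability at most $\delta$ is a random $i^*\in[n]\cup\{\bot\}$ with $\Pr[i^*=\bot]\le\delta$ and $$\Bigl|\Pr[i^*=i\mid i^*\ne\bot]-\frac{G(x_i)}{\sum_{j\in[n]}G(x_j)}\Bigr|\le n^{-c}\qquad\text{for all } i\in[n];$$ a perfect $L_0$-sample is the case $G(z)=1$ for $z\ne0$, $G(0)=0$. There is a streaming algorithm $B$ that uses at most $C\log^2 n$ bits of space and that, on every such stream with $x\ne 0$, outputs $\bot$ or a pair $(i^*,v)$, where $i^*$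 is a perfect $L_0$-sample from $x$ with failure probability at most $0.01$, and a pair with $v\neq x_{i^*}$ is output with probability at most $n^{-c}$. Moreover, let $G:\mathbb R\to[0,\infty)$ with $G(0)=0$, let $0<Q\le H$, and let $Z\subseteq\mathbb Z$ be such that $Q\le G(z)\le H$ for all $z\in Z$ (for example $Z=[m]$). Then there is a streaming algorithm $A$ that uses at most $C\cdot\frac HQ\cdot\log^2 n$ bits of space and that, on every such stream with $x\neq0$ whose nonzero coordinates $x_i$ all lie in $Z$, outputs a perfect $G$-sample from $x$ and succeeds (does not output $\bot$) with probability at least $0.99$. If $H/Q\le n^a$, then $A$ can be taken to be the following algorithm, for some $R\le C\cdot\frac HQ$: run $R$ independent copies of $B$ on the stream, then go through their outputs in order, skip $\bot$, accept a pair $(i,v)$ with probability $\min(1,G(v)/H)$ (which is $G(x_i)/H$ if $v=x_i\in Z$), and output the index of the first accepted pair, or $\bot$ if there is none. -/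

import Mathlib

open scoped NNReal ENNReal

/-- The frequency vector of a stream of updates `(i, Δ)`: the `i`-th coordinate is the sum of
all `Δ` that come with the index `i`. -/
def freq {n : ℕ} (s : List (Fin n × ℤ)) (i : Fin n) : ℤ :=
  ((s.filter (fun u => u.1 = i)).map Prod.snd).sum

/-- A turnstile stream with at most `m` updates, each in `{-M, …, M}`. -/
def IsTurnstileStream {n : ℕ} (m M : ℕ) (s : List (Fin n × ℤ)) : Prop :=
  s.length ≤ m ∧ ∀ u ∈ s, |u.2| ≤ (M : ℤ)

/-- A one-pass randomized streaming algorithm on updates `(i, Δ) ∈ [n] × ℤ`. Between two updates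
it remembers nothing but an element of the finite set `State`; random bits that are needed again
later are part of the state. Each step may use fresh coins. -/
structure StreamAlg (n : ℕ) (Out : Type) where
  State : Type
  finite_state : Finite State
  init : PMF State
  step : State → Fin n × ℤ → PMF State
  out : State → PMF Out

namespace StreamAlg

variable {n : ℕ} {Out : Type}

/-- The space in bits: the number of bits that it takes to write down a state. -/
noncomputable def bits (A : StreamAlg n Out) : ℕ := Nat.clog 2 (Nat.card A.State)

/-- The distribution of the state after the stream `s`. -/
noncomputable def run (A : StreamAlg n Out) (s : List (Fin n × ℤ)) : PMF A.State :=
  s.foldl (fun p u => p.bind (fun σ => A.step σ u)) A.init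

/-- The distribution of the output after the stream `s`. -/
noncomputable def output (A : StreamAlg n Out) (s : List (Fin n × ℤ)) : PMF Out :=
  (A.run s).bind A.out

end StreamAlg

/-- `p`, the law of a random index or the failure symbol `none`, is a perfect `G`-sample from `x`
with failure probability at most `δ` and additive error `n ^ (-c)`: conditioned on not failing,
each index `i` has probability `G (x i) / ∑ j, G (x j) ± n ^ (-c)`. -/
structure IsPerfectSample {n : ℕ} (G : ℝ → ℝ) (δ c : ℝ) (x : Fin n → ℤ)
    (p : PMF (Option (Fin n))) : Prop where
  fail_le : (p none).toReal ≤ δ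
  cond_law : ∀ i : Fin n,
    |(p (some i)).toReal / (1 - (p none).toReal) - G (x i) / ∑ j, G (x j)| ≤ (n : ℝ) ^ (-c)

/-- `p`, the law of a random pair (index, value) or the failure symbol `none`, is a perfect
`L_0`-sample from `x` (the case `G z = 1` for `z ≠ 0`, `G 0 = 0`), where the value that comes with
the index `i` is exactly `x i`, up to an event of probability at most `n ^ (-c)`. -/
structure IsPerfectL0Sample {n : ℕ} (δ c : ℝ) (x : Fin n → ℤ)
    (p : PMF (Option (Fin n × ℤ))) : Prop where
  index : IsPerfectSample (fun z => if z = 0 then 0 else 1) δ c x (p.map (Option.map Prod.fst))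
  value : (p.toOuterMeasure {o | ∃ i v, o = some (i, v) ∧ v ≠ x i}).toReal ≤ (n : ℝ) ^ (-c)

/-- The law of independent draws from `p 0, …, p (R - 1)`. -/
noncomputable def indepDraws {α : Type} : {R : ℕ} → (Fin R → PMF α) → PMF (Fin R → α)
  | 0, _ => PMF.pure Fin.elim0
  | _ + 1, p => (p 0).bind fun a =>
      (indepDraws (fun r => p r.succ)).map fun f => Fin.cons a f

/-- The probability `G v / H` of accepting a sample of value `v`. It is cut off at `1`, which
matters only for values `v` with `G v > H`. -/
noncomputable def acceptProb (G : ℝ → ℝ) (H : ℝ) (v : ℤ) : ℝ≥0 :=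
  min 1 (G v / H).toNNReal

/-- A coin that shows `true` with probability `p`. -/
noncomputable def coin (p : ℝ≥0) (hp : p ≤ 1) : PMF Bool :=
  PMF.ofFintype (fun b => if b then (p : ℝ≥0∞) else 1 - p) (by
    have h : (p : ℝ≥0∞) ≤ 1 := by exact_mod_cast hp
    simpa using add_tsub_cancel_of_le h)

/-- Go through a list of samples, skip the failed ones, accept a sample `(i, v)` with probability
`acceptProb G H v`, and return the index of the first one accepted (`none` if there is none). -/
noncomputable def firstAccepted {n : ℕ} (G : ℝ → ℝ) (H : ℝ) :
    List (Option (Fin n × ℤ)) → PMF (Option (Fin n))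
  | [] => PMF.pure none
  | none :: l => firstAccepted G H l
  | some (i, v) :: l =>
      (coin (acceptProb G H v) (min_le_left _ _)).bind fun b =>
        if b then PMF.pure (some i) else firstAccepted G H l

/-- Rejection sampling: run `R` independent copies of `B` on the stream, and at the end return the
index of the first sample accepted. -/
noncomputable def rejectionSampler {n : ℕ} (B : StreamAlg n (Option (Fin n × ℤ)))
    (G : ℝ → ℝ) (H : ℝ) (R : ℕ) : StreamAlg n (Option (Fin n)) where
  State := Fin R → B.State
  finite_state := by
    have := B.finite_state
    infer_instance
  init := indepDraws (fun _ => B.init)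
  step σ u := indepDraws (fun r => B.step (σ r) u)
  out σ := (indepDraws (fun r => B.out (σ r))).bind fun o => firstAccepted G H (List.ofFn o)

/-! Draw, for each of O(log n) sampling rates and each of 40 repetitions, a random subset of [n]
together with a random hash in `ZMod p` for every index, and keep the counter ∑ hash(i)·x_i mod p
over the subset. If the rate is near 1/|supp x|, the subset meets the support in exactly one index
with probability at least 1/8 (`prob_soleIndex_eq_none_le`), so all tests fail with probability at
most (7/8)^40 ≤ 1/200. The construction is symmetric in the support, so the isolated index is
exactly uniform given success (`prob_isolatedIndex`). A counter reveals that index and its value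
unless a nonzero difference vector hashes to zero, which has probability 1/p for each candidate
(`prob_collision_le`, `prob_decode_ne_le`).

These random choices are far too long to store. A Chernoff and union bound over all vectors with
small entries shows that a fixed list of polynomially many seeds reproduces all relevant
probabilities up to ε = n^(-e) (`exists_sample`, `exists_seeds`). The state is then a seed number of
O(log n) bits and O(log n) counters of O(log n) bits each: O(log² n) in total.

For G, one sample survives the accept step with probability at least about Q/H, and the accepted
index has law proportional to G(x_i), up to an error controlled by ε. Thus O(H/Q) copies suffice
(`IsApproxUniform.thinning`, `firstAcceptedLaw_cond`). The error is harmless only while H/Q ≤ n^a.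
Beyond that, the space bound allows storing the whole stream and sampling exactly. -/

open Classical in
/-- The probability of `E` under the uniform distribution on a finite type. -/
noncomputable def prob {Ω : Type*} [Fintype Ω] (E : Ω → Prop) : ℝ :=
  ((Finset.univ.filter E).card : ℝ) / Fintype.card Ω

/-! ### Uniform probability on finite types -/

section Prob

variable {Ω : Type*} [Fintype Ω]

theorem prob_eq_card (E : Ω → Prop) [DecidablePred E] :
    prob E = ((Finset.univ.filter E).card : ℝ) / Fintype.card Ω := by
  unfold prob
  congr!

theorem prob_eq_sum (E : Ω → Prop) [DecidablePred E] :
    prob E = (∑ ω, if E ω then (1 : ℝ) else 0) / Fintype.card Ω := by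
  rw [prob_eq_card, Finset.sum_boole]

theorem prob_nonneg (E : Ω → Prop) : 0 ≤ prob E := by
  unfold prob; positivity

theorem prob_mono {E F : Ω → Prop} (h : ∀ ω, E ω → F ω) : prob E ≤ prob F := by
  classical
  unfold prob
  gcongr with ω
  exact h ω

theorem prob_le_one (E : Ω → Prop) : prob E ≤ 1 := by
  classical
  unfold prob
  apply div_le_one_of_le₀ _ (by positivity)
  exact_mod_cast Finset.card_le_univ _

theorem prob_exists_le {ι : Type*} [Fintype ι] (E : ι → Ω → Prop) :
    prob (fun ω => ∃ i, E i ω) ≤ ∑ i, prob (E i) := by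
  classical
  simp_rw [prob_eq_card]
  rw [← Finset.sum_div]
  gcongr
  have : (Finset.univ.filter fun ω => ∃ i, E i ω)
      = Finset.univ.biUnion fun i => Finset.univ.filter (E i) := by
    ext ω; simp
  rw [this]
  exact_mod_cast Finset.card_biUnion_le

theorem prob_comp_equiv (e : Ω ≃ Ω) (E : Ω → Prop) : prob (fun ω => E (e ω)) = prob E := by
  classical
  rw [prob_eq_sum, prob_eq_sum]
  congr 1
  exact Equiv.sum_comp e (fun ω => if E ω then (1 : ℝ) else 0)

/-- The uniform distribution on a product is the product of the uniform distributions. -/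
theorem prob_forall {ι : Type*} [Fintype ι] [DecidableEq ι] {W : Type*} [Fintype W] (E : ι → W → Prop) :
    prob (fun ω : ι → W => ∀ i, E i (ω i)) = ∏ i, prob (E i) := by
  classical
  simp_rw [prob_eq_card]
  rw [Finset.prod_div_distrib]
  congr 1
  · have : (Finset.univ.filter fun ω : ι → W => ∀ i, E i (ω i))
        = Fintype.piFinset fun i => Finset.univ.filter (E i) := by
      ext ω; simp
    rw [this, Fintype.card_piFinset]
    push_cast
    rfl
  · simp

theorem prob_apply {ι : Type*} [Fintype ι] [DecidableEq ι] {W : Type*} [Fintype W] [Nonempty W]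
    (i : ι) (E : W → Prop) : prob (fun ω : ι → W => E (ω i)) = prob E := by
  classical
  have h := prob_forall (fun j w => j = i → E w : ι → W → Prop)
  have h1 : (fun ω : ι → W => ∀ j, j = i → E (ω j)) = fun ω => E (ω i) := by
    funext ω; simp
  rw [h1] at h
  rw [h, Finset.prod_eq_single i]
  · simp
  · intro j _ hj
    simp [prob, hj]
  · simp

open Classical in
/-- The law of total probability for an option-valued function. -/
theorem prob_none_add_sum {ι : Type*} [Fintype ι] [Nonempty Ω] (I : Ω → Option ι) :
    prob (fun ω => I ω = none) + ∑ i, prob (fun ω => I ω = some i) = 1 := by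
  have h : ∑ o : Option ι, prob (fun ω => I ω = o) = 1 := by
    simp_rw [prob_eq_sum]
    rw [← Finset.sum_div, Finset.sum_comm]
    simp only [Finset.sum_ite_eq, Finset.mem_univ, if_true]
    simp
  rwa [Fintype.sum_option] at h

end Prob

/-! ### Chernoff bound and approximation by a small sample -/

section Chernoff

variable {Ω : Type*} [Fintype Ω] [Nonempty Ω]

/-- Uses e^y ≤ 1 + y + y² for |y| ≤ 1; the linear term sums to zero. -/
theorem sum_exp_le (X : Ω → ℝ) (h0 : ∑ ω, X ω = 0) (h1 : ∀ ω, |X ω| ≤ 1) {l : ℝ}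
    (hl : 0 ≤ l) (hl1 : l ≤ 1) :
    ∑ ω, Real.exp (l * X ω) ≤ Fintype.card Ω * Real.exp (l ^ 2) := by
  have h : ∀ ω, Real.exp (l * X ω) ≤ 1 + l ^ 2 + l * X ω := by
    intro ω
    have hb : |l * X ω| ≤ l := by
      rw [abs_mul, abs_of_nonneg hl]
      exact mul_le_of_le_one_right hl (h1 ω)
    have h2 := (abs_le.1 (Real.abs_exp_sub_one_sub_id_le (hb.trans hl1))).2
    have h3 : (l * X ω) ^ 2 ≤ l ^ 2 := sq_le_sq' (by linarith [(abs_le.1 hb).1]) (abs_le.1 hb).2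
    linarith
  calc ∑ ω, Real.exp (l * X ω) ≤ ∑ ω, (1 + l ^ 2 + l * X ω) := Finset.sum_le_sum fun ω _ => h ω
    _ = Fintype.card Ω * (1 + l ^ 2) := by
      rw [Finset.sum_add_distrib, ← Finset.mul_sum, h0]; simp [mul_add]
    _ ≤ _ := by
      gcongr
      linarith [Real.add_one_le_exp (l ^ 2)]

/-- A Chernoff bound for the average of independent uniform draws. -/
theorem prob_sum_gt_le (X : Ω → ℝ) (h0 : ∑ ω, X ω = 0) (h1 : ∀ ω, |X ω| ≤ 1) {ε : ℝ}
    (hε : 0 ≤ ε) (hε1 : ε ≤ 1) (t : ℕ) :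
    prob (fun ω : Fin t → Ω => ε * t < ∑ r, X (ω r)) ≤ Real.exp (-(ε ^ 2 * t / 4)) := by
  classical
  -- This value minimises the exponent l² - lε, giving -ε²/4.
  set l := ε / 2 with hl
  have hprod : ∑ ω : Fin t → Ω, Real.exp (l * ∑ r, X (ω r))
      ≤ (Fintype.card Ω : ℝ) ^ t * Real.exp (l ^ 2 * t) := by
    have : ∀ ω : Fin t → Ω, Real.exp (l * ∑ r, X (ω r)) = ∏ r, Real.exp (l * X (ω r)) := by
      intro ω; rw [Finset.mul_sum, Real.exp_sum]
    simp_rw [this]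
    rw [← Fintype.sum_pow (fun ω => Real.exp (l * X ω)), mul_comm (l ^ 2), Real.exp_nat_mul,
      ← mul_pow]
    gcongr
    exact sum_exp_le X h0 h1 (by positivity) (by linarith)
  have hc : (0 : ℝ) < (Fintype.card Ω : ℝ) ^ t := by
    have : 0 < Fintype.card Ω := Fintype.card_pos
    positivity
  rw [prob_eq_sum, div_le_iff₀ (by simpa using hc)]
  have hle : ∀ ω : Fin t → Ω, (if ε * t < ∑ r, X (ω r) then (1 : ℝ) else 0)
      ≤ Real.exp (l * ∑ r, X (ω r)) * Real.exp (-(l * (ε * t))) := by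
    intro ω
    split_ifs with h
    · rw [← Real.exp_add]
      apply Real.one_le_exp
      have : 0 ≤ l := by positivity
      nlinarith
    · positivity
  calc _ ≤ ∑ ω : Fin t → Ω, Real.exp (l * ∑ r, X (ω r)) * Real.exp (-(l * (ε * t))) :=
        Finset.sum_le_sum fun ω _ => hle ω
    _ ≤ (Fintype.card Ω : ℝ) ^ t * Real.exp (l ^ 2 * t) * Real.exp (-(l * (ε * t))) := by
        rw [← Finset.sum_mul]; gcongr
    _ = _ := by
        rw [mul_assoc, ← Real.exp_add, mul_comm]
        simp only [Fintype.card_pi, Finset.prod_const, Finset.card_univ, Fintype.card_fin,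
          Nat.cast_pow]
        congr 2
        rw [hl]; ring

theorem prob_abs_sub_gt_le (E : Ω → Prop) {ε : ℝ} (hε : 0 ≤ ε) (hε1 : ε ≤ 1) (t : ℕ)
    (ht : 0 < t) :
    prob (fun ω : Fin t → Ω => ε < |prob (fun r => E (ω r)) - prob E|)
      ≤ 2 * Real.exp (-(ε ^ 2 * t / 4)) := by
  classical
  have hN : (0 : ℝ) < Fintype.card Ω := by exact_mod_cast Fintype.card_pos
  set X : Ω → ℝ := fun ω => (if E ω then 1 else 0) - prob E with hX
  have h0 : ∑ ω, X ω = 0 := by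
    simp only [hX, Finset.sum_sub_distrib, Finset.sum_const, Finset.card_univ, nsmul_eq_mul]
    rw [prob_eq_sum]
    field_simp
    simp
  have h1 : ∀ ω, |X ω| ≤ 1 := by
    intro ω
    have := prob_nonneg E
    have := prob_le_one E
    simp only [hX]
    rw [abs_le]
    split_ifs <;> constructor <;> linarith
  have hsum : ∀ ω : Fin t → Ω, ∑ r, X (ω r) = (prob (fun r => E (ω r)) - prob E) * t := by
    intro ω
    have : (t : ℝ) ≠ 0 := by positivity
    rw [prob_eq_sum (fun r => E (ω r))]
    simp only [hX, Finset.sum_sub_distrib, Finset.sum_const, Finset.card_univ, nsmul_eq_mul,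
      Fintype.card_fin]
    field_simp
  have hA := prob_sum_gt_le X h0 h1 hε hε1 t
  have hB := prob_sum_gt_le (fun ω => -X ω) (by simp [h0]) (by simpa using h1) hε hε1 t
  have hor : prob (fun ω : Fin t → Ω => ε < |prob (fun r => E (ω r)) - prob E|)
      ≤ ∑ b : Bool, prob (fun ω : Fin t → Ω =>
        ε * t < ∑ r, (bif b then X (ω r) else -X (ω r))) := by
    refine le_trans (prob_mono ?_) (prob_exists_le _)
    intro ω h
    have ht' : (0 : ℝ) < t := by exact_mod_cast ht
    rcases lt_abs.1 h with h | h
    · exact ⟨true, by simp only [cond_true, hsum]; gcongr⟩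
    · refine ⟨false, ?_⟩
      simp only [cond_false, Finset.sum_neg_distrib, hsum]
      rw [← neg_mul]
      gcongr
  rw [Fintype.sum_bool] at hor
  simp only [cond_true, cond_false] at hor
  linarith

/-- Finitely many events on a finite probability space are simultaneously approximated by a
small sample of points. -/
theorem exists_sample {ι : Type*} [Fintype ι] (E : ι → Ω → Prop) {ε : ℝ} (hε : 0 ≤ ε)
    (hε1 : ε ≤ 1) (t : ℕ) (h0 : 0 < t)
    (ht : 2 * (Fintype.card ι : ℝ) < Real.exp (ε ^ 2 * t / 4)) :
    ∃ ω : Fin t → Ω, ∀ e, |prob (fun r => E e (ω r)) - prob (E e)| ≤ ε := by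
  classical
  -- Probabilistic method: if every sample were bad for some event, the union bound would give total
  -- probability below 1.
  by_contra! hcon
  have h1 : prob (fun ω : Fin t → Ω => ∃ e, ε < |prob (fun r => E e (ω r)) - prob (E e)|) = 1 := by
    rw [funext fun ω => eq_true (hcon ω)]
    simp [prob]
  have h2 := prob_exists_le
    (fun e (ω : Fin t → Ω) => ε < |prob (fun r => E e (ω r)) - prob (E e)|)
  rw [h1] at h2
  have h3 := h2.trans (Finset.sum_le_sum fun e _ => prob_abs_sub_gt_le (E e) hε hε1 t h0)
  rw [Finset.sum_const, Finset.card_univ, nsmul_eq_mul, Real.exp_neg] at h3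
  have hp := Real.exp_pos (ε ^ 2 * t / 4)
  have : (Fintype.card ι : ℝ) * (2 * (Real.exp (ε ^ 2 * t / 4))⁻¹) < 1 := by
    rw [← mul_assoc, ← div_eq_mul_inv, div_lt_one hp]
    linarith
  linarith

end Chernoff

/-! ### Isolating a uniform element of a set by symmetric tests -/

section Select

variable {J α β : Type*}

open Classical in
/-- Some value of `f` other than `none`, if there is one. The position where it is taken depends
only on the set of positions where `f` is not `none`. -/
noncomputable def select (f : J → Option α) : Option α :=
  if h : ∃ j, (f j).isSome = true then f h.choose else none

theorem select_map (g : α → β) (f : J → Option α) :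
    select (fun j => (f j).map g) = (select f).map g := by
  by_cases h : ∃ j, (f j).isSome = true
  · have h' : ∃ j, ((f j).map g).isSome = true := by simpa using h
    -- Both choices are made from the same predicate, since mapping preserves which entries are
    -- `none`.
    have hc : h'.choose = h.choose := by
      congr 1
      funext j
      simp
    rw [select, select, dif_pos h', dif_pos h, hc]
  · have h' : ¬ ∃ j, ((f j).map g).isSome = true := by simpa using h
    rw [select, select, dif_neg h', dif_neg h]
    rfl

theorem select_eq_none_iff (f : J → Option α) : select f = none ↔ ∀ j, f j = none := by
  unfold select
  split_ifs with h
  · constructor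
    · intro h'
      have := h.choose_spec
      simp [h'] at this
    · intro h'; exact h' _
  · simpa using h

theorem exists_of_select_eq_some {f : J → Option α} {a : α} (h : select f = some a) :
    ∃ j, f j = some a := by
  unfold select at h
  split_ifs at h with h'
  exact ⟨_, h⟩

end Select

section SoleIndex

variable {ι : Type*}

open Classical in
/-- The only element of `T` that satisfies `S`, if there is exactly one. -/
noncomputable def soleIndex (T : Set ι) (S : ι → Prop) : Option ι :=
  if h : ∃ i, (i ∈ T ∧ S i) ∧ ∀ j ∈ T, S j → j = i then some h.choose else none

theorem soleIndex_eq_some_iff (T : Set ι) (S : ι → Prop) (i : ι) :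
    soleIndex T S = some i ↔ (i ∈ T ∧ S i) ∧ ∀ j ∈ T, S j → j = i := by
  unfold soleIndex
  split_ifs with h
  · have hs := h.choose_spec
    constructor
    · intro h'
      rw [← Option.some.inj h']
      exact hs
    · intro h'
      rw [h'.2 _ hs.1.1 hs.1.2]
  · simp only [false_iff]
    exact fun h' => h ⟨i, h'⟩

/-- Equivariance under permutations preserving `T`; this is the source of uniformity of the isolated
index. -/
theorem soleIndex_comp_equiv (T : Set ι) (S : ι → Prop) (σ : ι ≃ ι)
    (hσ : ∀ i, σ i ∈ T ↔ i ∈ T) :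
    soleIndex T (fun i => S (σ i)) = (soleIndex T S).map σ.symm := by
  ext i
  rw [soleIndex_eq_some_iff, Option.map_eq_some_iff]
  constructor
  · rintro ⟨⟨h1, h2⟩, h3⟩
    refine ⟨σ i, ?_, by simp⟩
    rw [soleIndex_eq_some_iff]
    refine ⟨⟨(hσ i).2 h1, h2⟩, fun j hj hS => ?_⟩
    rw [← h3 (σ.symm j) ((hσ _).1 (by simpa)) (by simpa)]
    simp
  · rintro ⟨k, hk, rfl⟩
    rw [soleIndex_eq_some_iff] at hk
    refine ⟨⟨(hσ _).1 (by simpa using hk.1.1), by simpa using hk.1.2⟩, fun j hj hS => ?_⟩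
    rw [← hk.2 (σ j) ((hσ _).2 hj) hS]
    simp

end SoleIndex

section Sampling

variable {n : ℕ} {J W : Type*}

/-- The index found by one of the tests `j ∈ J`: the test `j` isolates an element of `T` if it is
the only one that satisfies `U j`. -/
noncomputable def isolatedIndex (U : J → W → Prop) (T : Set (Fin n)) (ω : J → Fin n → W) :
    Option (Fin n) :=
  select fun j => soleIndex T fun i => U j (ω j i)

theorem isolatedIndex_mem {U : J → W → Prop} {T : Set (Fin n)} {ω : J → Fin n → W} {i : Fin n}
    (h : isolatedIndex U T ω = some i) : i ∈ T := by
  obtain ⟨j, hj⟩ := exists_of_select_eq_some h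
  exact ((soleIndex_eq_some_iff _ _ _).1 hj).1.1

variable [Fintype J] [DecidableEq J] [Fintype W]

/-- Swapping the random choices of `i` and `i'` in every test preserves the uniform measure and
swaps the two outcomes, as `select` does not look at which index a test has found. -/
theorem prob_isolatedIndex_eq (U : J → W → Prop) (T : Set (Fin n)) {i i' : Fin n} (hi : i ∈ T)
    (hi' : i' ∈ T) :
    prob (fun ω => isolatedIndex U T ω = some i) = prob (fun ω => isolatedIndex U T ω = some i') := by
  classical
  set σ := Equiv.swap i i'
  have hσ : ∀ k, σ k ∈ T ↔ k ∈ T := by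
    intro k
    simp only [σ, Equiv.swap_apply_def]
    split_ifs with h1 h2
    · simp [h1, hi, hi']
    · simp [h2, hi, hi']
    · rfl
  let e : (J → Fin n → W) ≃ (J → Fin n → W) :=
    { toFun := fun ω j k => ω j (σ k)
      invFun := fun ω j k => ω j (σ k)
      left_inv := fun ω => by funext j k; simp [σ]
      right_inv := fun ω => by funext j k; simp [σ] }
  rw [← prob_comp_equiv e]
  congr 1
  funext ω
  have : isolatedIndex U T (e ω) = (isolatedIndex U T ω).map σ.symm := by
    unfold isolatedIndex
    rw [← select_map]
    congr 1
    funext j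
    exact soleIndex_comp_equiv T (fun k => U j (ω j k)) σ hσ
  rw [this]
  simp only [Option.map_eq_some_iff, eq_iff_iff]
  constructor
  · rintro ⟨k, hk, hk'⟩
    rw [hk, ← σ.apply_symm_apply k, hk']
    simp [σ]
  · intro h
    exact ⟨i', h, by simp [σ]⟩

variable [Nonempty W]

/-- Given that some test isolates an index, it is uniformly distributed. -/
theorem prob_isolatedIndex (U : J → W → Prop) (T : Finset (Fin n)) {i : Fin n} (hi : i ∈ T) :
    prob (fun ω => isolatedIndex U (T : Set (Fin n)) ω = some i)
      = (1 - prob (fun ω => isolatedIndex U (T : Set (Fin n)) ω = none)) / T.card := by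
  classical
  have h := prob_none_add_sum (isolatedIndex U (T : Set (Fin n)))
  have hT : (T.card : ℝ) ≠ 0 := by exact_mod_cast (Finset.card_pos.2 ⟨i, hi⟩).ne'
  rw [eq_div_iff hT, ← h, add_sub_cancel_left]
  rw [← Finset.sum_subset (Finset.subset_univ T)]
  · rw [Finset.sum_congr rfl fun k hk =>
      prob_isolatedIndex_eq U (T : Set (Fin n)) (Finset.mem_coe.2 hk) (Finset.mem_coe.2 hi)]
    rw [Finset.sum_const, nsmul_eq_mul, mul_comm]
  · intro k _ hk
    rw [prob_eq_card, Finset.filter_eq_empty_iff.2]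
    · simp
    · intro ω _ h'
      exact hk (Finset.mem_coe.1 (isolatedIndex_mem h'))

theorem prob_not (E : W → Prop) : prob (fun w => ¬ E w) = 1 - prob E := by
  classical
  have hN : (Fintype.card W : ℝ) ≠ 0 := by exact_mod_cast Fintype.card_ne_zero
  rw [prob_eq_card, prob_eq_card, eq_sub_iff_add_eq, ← add_div, div_eq_one_iff_eq hN, add_comm]
  exact_mod_cast Finset.card_filter_add_card_filter_not (s := Finset.univ) E

theorem prob_soleIndex_eq_some (U : W → Prop) (T : Finset (Fin n)) {i : Fin n} (hi : i ∈ T) :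
    prob (fun w : Fin n → W => soleIndex (T : Set (Fin n)) (fun k => U (w k)) = some i)
      = prob U * (1 - prob U) ^ (T.card - 1) := by
  classical
  have h := prob_forall (fun k w => if k = i then U w else (k ∈ T → ¬ U w) : Fin n → W → Prop)
  have h1 : (fun w : Fin n → W => soleIndex (T : Set (Fin n)) (fun k => U (w k)) = some i)
      = fun w => ∀ k, if k = i then U (w k) else (k ∈ T → ¬ U (w k)) := by
    funext w
    rw [soleIndex_eq_some_iff, eq_iff_iff]
    constructor
    · rintro ⟨⟨_, h2⟩, h3⟩ k
      split_ifs with hk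
      · exact hk ▸ h2
      · exact fun hkT hU => hk (h3 k (by simpa using hkT) hU)
    · intro h2
      refine ⟨⟨by simpa using hi, by simpa using h2 i⟩, fun j hj hU => ?_⟩
      by_contra hne
      have := h2 j
      rw [if_neg hne] at this
      exact this (by simpa using hj) hU
  rw [h1, h, ← Finset.mul_prod_erase Finset.univ _ (Finset.mem_univ i)]
  simp only [if_true]
  congr 1
  rw [← Finset.prod_subset (Finset.erase_subset_erase i (Finset.subset_univ T))]
  · rw [← Finset.card_erase_of_mem hi, ← Finset.prod_const]
    refine Finset.prod_congr rfl fun k hk => ?_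
    rw [← prob_not]
    simp [Finset.ne_of_mem_erase hk, Finset.mem_of_mem_erase hk]
  · intro k hk hk'
    have hki := Finset.ne_of_mem_erase hk
    have hkT : k ∉ T := fun hh => hk' (Finset.mem_erase.2 ⟨hki, hh⟩)
    simp [hki, hkT, prob]

/-- A set of `k` elements is sampled at a rate near `1 / k`: exactly one element is hit with
constant probability. -/
theorem prob_soleIndex_eq_none_le (U : W → Prop) (T : Finset (Fin n))
    (h1 : 1 / 4 ≤ T.card * prob U) (h2 : T.card * prob U ≤ 1 / 2) :
    prob (fun w : Fin n → W => soleIndex (T : Set (Fin n)) (fun k => U (w k)) = none) ≤ 7 / 8 := by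
  classical
  have h := prob_none_add_sum
    (fun w : Fin n → W => soleIndex (T : Set (Fin n)) (fun k => U (w k)))
  have hs : ∑ i ∈ T, prob (fun w : Fin n → W =>
      soleIndex (T : Set (Fin n)) (fun k => U (w k)) = some i)
      ≤ ∑ i, prob (fun w : Fin n → W =>
      soleIndex (T : Set (Fin n)) (fun k => U (w k)) = some i) :=
    Finset.sum_le_sum_of_subset_of_nonneg (Finset.subset_univ T) fun _ _ _ => prob_nonneg _
  rw [Finset.sum_congr rfl fun i hi => prob_soleIndex_eq_some U T hi, Finset.sum_const,
    nsmul_eq_mul] at hs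
  have hp0 := prob_nonneg U
  have hp1 := prob_le_one U
  have hk : 0 < T.card := by
    rcases Nat.eq_zero_or_pos T.card with h0 | h0
    · rw [h0] at h1; norm_num at h1
    · exact h0
  -- Bernoulli: (1 - q)^(k-1) ≥ 1 - (k-1)q ≥ 1/2 for k = |T| and q = `prob U`, so the success
  -- probability kq(1-q)^(k-1) is at least 1/8.
  have hb := one_add_mul_le_pow (a := -prob U) (by linarith) (T.card - 1)
  rw [Nat.cast_sub hk] at hb
  have : 1 / 8 ≤ (T.card : ℝ) * (prob U * (1 - prob U) ^ (T.card - 1)) := by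
    rw [← mul_assoc]
    have h3 : 1 / 2 ≤ (1 - prob U) ^ (T.card - 1) := by
      rw [← sub_eq_add_neg] at hb
      push_cast at hb
      nlinarith
    nlinarith
  linarith

end Sampling

section Fail

variable {n : ℕ} {Λ κ W : Type*} [Fintype Λ] [DecidableEq Λ] [Fintype κ] [DecidableEq κ]
  [Fintype W] [Nonempty W]

/-- With a group `κ` of independent tests for each rate in `Λ`, one of which fits the size of `T`,
it is unlikely that all tests fail. -/
theorem prob_isolatedIndex_eq_none_le (U : Λ → W → Prop) (T : Finset (Fin n)) (l : Λ)
    (h1 : 1 / 4 ≤ T.card * prob (U l)) (h2 : T.card * prob (U l) ≤ 1 / 2) :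
    prob (fun ω : Λ × κ → Fin n → W =>
      isolatedIndex (fun j => U j.1) (T : Set (Fin n)) ω = none)
      ≤ (7 / 8) ^ Fintype.card κ := by
  classical
  have h := prob_forall (fun (j : Λ × κ) (w : Fin n → W) =>
    soleIndex (T : Set (Fin n)) (fun k => U j.1 (w k)) = none)
  have he : (fun ω : Λ × κ → Fin n → W =>
      isolatedIndex (fun j => U j.1) (T : Set (Fin n)) ω = none)
      = fun ω => ∀ j, soleIndex (T : Set (Fin n)) (fun k => U j.1 (ω j k)) = none := by
    funext ω
    exact propext (select_eq_none_iff _)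
  rw [he, h, Fintype.prod_prod_type, ← Finset.mul_prod_erase Finset.univ _ (Finset.mem_univ l)]
  simp only [Finset.prod_const, Finset.card_univ]
  have h3 := prob_soleIndex_eq_none_le (U l) T h1 h2
  calc _ ≤ prob (fun w : Fin n → W =>
        soleIndex (T : Set (Fin n)) (fun k => U l (w k)) = none) ^ Fintype.card κ * 1 := by
        refine mul_le_mul_of_nonneg_left ?_ (pow_nonneg (prob_nonneg _) _)
        exact Finset.prod_le_one (fun _ _ => pow_nonneg (prob_nonneg _) _)
          fun _ _ => pow_le_one₀ (prob_nonneg _) (prob_le_one _)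
    _ ≤ _ := by
        rw [mul_one]
        exact pow_le_pow_left₀ (prob_nonneg _) h3 _

end Fail

/-! ### Hashed counters and their collision probability -/

section Sketch

variable {n : ℕ} {A : Type*} {p : ℕ}

open Classical in
/-- The weight of coordinate `i` in a test: the hash `(w i).2` if `i` takes part in it. -/
noncomputable def weight (U : A → Prop) (w : Fin n → A × ZMod p) (i : Fin n) : ZMod p :=
  if U (w i).1 then (w i).2 else 0

/-- The counter of a test for the vector `x`. -/
noncomputable def counter (U : A → Prop) (w : Fin n → A × ZMod p) (x : Fin n → ℤ) : ZMod p :=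
  ∑ i, weight U w i * x i

/-- The counter of a test is zero although the part of `d` that takes part in it is not. -/
def Collision (U : A → Prop) (d : Fin n → ℤ) (w : Fin n → A × ZMod p) : Prop :=
  (∃ i, U (w i).1 ∧ d i ≠ 0) ∧ counter U w d = 0

theorem counter_update (U : A → Prop) (w : Fin n → A × ZMod p) (d : Fin n → ℤ) (i : Fin n)
    (hi : U (w i).1) (u : ZMod p) :
    counter U (Function.update w i ((w i).1, (w i).2 + u)) d = counter U w d + u * d i := by
  classical
  unfold counter
  rw [← Finset.add_sum_erase Finset.univ _ (Finset.mem_univ i),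
    ← Finset.add_sum_erase Finset.univ (fun k => weight U w k * (d k : ZMod p)) (Finset.mem_univ i)]
  have : ∀ k ∈ Finset.univ.erase i,
      weight U (Function.update w i ((w i).1, (w i).2 + u)) k * (d k : ZMod p)
        = weight U w k * (d k : ZMod p) := by
    intro k hk
    simp [weight, Function.update_of_ne (Finset.ne_of_mem_erase hk)]
  rw [Finset.sum_congr rfl this]
  simp only [weight, Function.update_self, if_pos hi]
  ring

variable [Fintype A] [Nonempty A] [Fact p.Prime]

/-- Shift the hash of one participating coordinate with d_i ≠ 0 by u. Starting from a collision, the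
new counter is u·d_i, which determines u. So the shift map is injective on collisions × `ZMod p`,
and collisions make up at most a 1/p fraction of all choices. -/
theorem prob_collision_le (U : A → Prop) (d : Fin n → ℤ)
    (hd : ∀ i, (d i : ZMod p) = 0 → d i = 0) :
    prob (Collision (p := p) U d) ≤ 1 / p := by
  classical
  have hp : 0 < p := (Fact.out : p.Prime).pos
  let P : (Fin n → A) → Prop := fun b => ∃ i, U (b i) ∧ d i ≠ 0
  let f : (Fin n → A × ZMod p) × ZMod p → (Fin n → A × ZMod p) := fun q =>
    if h : P (fun i => (q.1 i).1) then
      Function.update q.1 h.choose ((q.1 h.choose).1, (q.1 h.choose).2 + q.2)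
    else q.1
  have hfst : ∀ q i, (f q i).1 = (q.1 i).1 := by
    intro q i
    simp only [f]
    split_ifs with h
    · by_cases hi : i = h.choose
      · rw [hi]; simp
      · rw [Function.update_of_ne hi]
    · rfl
  have hinj : Set.InjOn f
      ((Finset.univ.filter (Collision (p := p) U d)) ×ˢ (Finset.univ : Finset (ZMod p)) :
        Finset _) := by
    rintro ⟨w, u⟩ hw ⟨w', u'⟩ hw' hf
    simp only [Finset.coe_product, Finset.coe_filter, Finset.mem_univ, true_and, Set.mem_prod,
      Set.mem_ofPred_eq, Finset.coe_univ, Set.mem_univ, and_true] at hw hw'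
    have hb : (fun i => (w i).1) = fun i => (w' i).1 := by
      funext i
      rw [← hfst (w, u) i, hf, hfst]
    have hP : P (fun i => (w i).1) := hw.1
    -- The shifted coordinate depends only on the first components, which the shift leaves alone, so
    -- it can be recovered from the image.
    have key : ∀ (v : Fin n → A × ZMod p) (s : ZMod p) (hv : (fun i => (v i).1) = fun i => (w i).1),
        f (v, s) = Function.update v hP.choose ((v hP.choose).1, (v hP.choose).2 + s) := by
      intro v s hv
      have hPv : P (fun i => (v i).1) := by rw [hv]; exact hP
      have : hPv.choose = hP.choose := by
        congr 1
        funext i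
        have hi := congrFun hv i
        simp only [hi]
      simp only [f, dif_pos hPv, this]
    rw [key w u rfl, key w' u' hb.symm] at hf
    obtain ⟨hU, hdi⟩ := hP.choose_spec
    have hU' : U (w' hP.choose).1 := by rw [← congrFun hb hP.choose]; exact hU
    have hc := congrArg (fun v => counter U v d) hf
    simp only [counter_update U w d _ hU, counter_update U w' d _ hU', hw.2, hw'.2, zero_add] at hc
    have hu : u = u' := mul_right_cancel₀ (fun h0 => hdi (hd _ h0)) hc
    subst hu
    have hww : w = w' := by
      funext k
      by_cases hk : k = hP.choose
      · have := congrFun hf hP.choose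
        simp only [Function.update_self, Prod.mk.injEq, add_left_inj] at this
        rw [hk]
        exact Prod.ext this.1 this.2
      · have := congrFun hf k
        rwa [Function.update_of_ne hk, Function.update_of_ne hk] at this
    rw [hww]
  have hcard := Finset.card_le_card_of_injOn f (t := Finset.univ) (fun _ _ => Finset.mem_univ _) hinj
  rw [Finset.card_product, Finset.card_univ, ZMod.card, Finset.card_univ] at hcard
  have hN : (0 : ℝ) < Fintype.card (Fin n → A × ZMod p) := by exact_mod_cast Fintype.card_pos
  rw [prob_eq_card, div_le_div_iff₀ hN (by exact_mod_cast hp), one_mul]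
  exact_mod_cast hcard

end Sketch

/-! ### Recovering the isolated index and its value from a counter -/

section Decode

variable {n : ℕ} {A J : Type*} {p : ℕ}

/-- The pair `(i, v)` explains the counter `F` of a test. -/
def Explains (V : ℕ) (U : A → Prop) (w : Fin n → A × ZMod p) (F : ZMod p) (q : Fin n × ℤ) : Prop :=
  U (w q.1).1 ∧ q.2 ≠ 0 ∧ |q.2| ≤ (V : ℤ) ∧ F = (w q.1).2 * q.2

open Classical in
/-- A pair that explains the counter of a test, if there is one. -/
noncomputable def decodeTest (V : ℕ) (U : A → Prop) (w : Fin n → A × ZMod p) (F : ZMod p) :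
    Option (Fin n × ℤ) :=
  if h : ∃ q, Explains V U w F q then some h.choose else none

/-- The result of a test that returns one. -/
noncomputable def decode (V : ℕ) (U : J → A → Prop) (ω : J → Fin n → A × ZMod p)
    (F : J → ZMod p) : Option (Fin n × ℤ) :=
  select fun j => decodeTest V (U j) (ω j) (F j)

theorem counter_sub_single (U : A → Prop) (w : Fin n → A × ZMod p) (x : Fin n → ℤ) (i : Fin n)
    (v : ℤ) : counter U w (x - Pi.single i v) = counter U w x - weight U w i * v := by
  classical
  simp only [counter, Pi.sub_apply, Int.cast_sub, mul_sub, Finset.sum_sub_distrib]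
  congr 1
  rw [Finset.sum_eq_single i]
  · simp
  · intro k _ hk; simp [hk]
  · simp

/-- If (i, v) explains the counter, then x - v·e_i has counter zero; without a collision it vanishes
on all participating coordinates, so `i` is the sole one and v = x_i. Conversely, a sole index
explains the counter with its value. -/
theorem decodeTest_counter (V : ℕ) (U : A → Prop) (w : Fin n → A × ZMod p) (x : Fin n → ℤ)
    (hx : ∀ i, |x i| ≤ (V : ℤ))
    (h : ∀ i v, |v| ≤ (V : ℤ) → ¬ Collision U (x - Pi.single i v) w) :
    decodeTest V U w (counter U w x)
      = (soleIndex {i | x i ≠ 0} fun i => U (w i).1).map fun i => (i, x i) := by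
  classical
  have key : ∀ q, Explains V U w (counter U w x) q →
      soleIndex {i | x i ≠ 0} (fun i => U (w i).1) = some q.1 ∧ q.2 = x q.1 := by
    rintro ⟨i, v⟩ ⟨hU, hv, hvV, hF⟩
    dsimp only at hU hv hvV hF
    have hc : counter U w (x - Pi.single i v) = 0 := by
      rw [counter_sub_single, hF, weight, if_pos hU, sub_self]
    have hz : ∀ k, U (w k).1 → x k = (Pi.single i v : Fin n → ℤ) k := by
      intro k hk
      by_contra hne
      exact h i v hvV ⟨⟨k, hk, sub_ne_zero.2 hne⟩, hc⟩
    have hxi : x i = v := by simpa using hz i hU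
    refine ⟨?_, hxi.symm⟩
    rw [soleIndex_eq_some_iff]
    refine ⟨⟨by simpa [hxi] using hv, hU⟩, fun k hk hkU => ?_⟩
    by_contra hne
    exact hk (by simpa [hne] using hz k hkU)
  unfold decodeTest
  split_ifs with hex
  · obtain ⟨h1, h2⟩ := key _ hex.choose_spec
    rw [h1]
    simp [← h2]
  · cases hs : soleIndex {i | x i ≠ 0} (fun i => U (w i).1) with
    | none => rfl
    | some i =>
      exfalso
      rw [soleIndex_eq_some_iff] at hs
      obtain ⟨⟨h1, h2⟩, h3⟩ := hs
      refine hex ⟨(i, x i), h2, h1, hx i, ?_⟩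
      unfold counter
      rw [Finset.sum_eq_single i]
      · simp [weight, h2]
      · intro k _ hk
        by_cases hkU : U (w k).1
        · have : x k = 0 := by
            by_contra hk0
            exact hk (h3 k hk0 hkU)
          simp [this]
        · simp [weight, hkU]
      · simp

theorem abs_sub_single_le (V : ℕ) (x : Fin n → ℤ) (hx : ∀ i, |x i| ≤ (V : ℤ)) (i : Fin n) {v : ℤ}
    (hv : |v| ≤ (V : ℤ)) (k : Fin n) : |(x - Pi.single i v : Fin n → ℤ) k| ≤ 2 * (V : ℤ) := by
  have hs : |(Pi.single i v : Fin n → ℤ) k| ≤ (V : ℤ) := by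
    by_cases hki : k = i
    · rw [hki]; simpa using hv
    · simp [hki]
  rw [Pi.sub_apply]
  linarith [abs_sub (x k) ((Pi.single i v : Fin n → ℤ) k), hx k]

theorem card_Icc_neg (V : ℕ) : Fintype.card (Set.Icc (-V : ℤ) V) = 2 * V + 1 := by
  rw [Fintype.card_ofFinset, Int.card_Icc]
  omega

variable [Fintype A] [Nonempty A] [Fact p.Prime] [Fintype J] [DecidableEq J]

/-- Decoding the counters returns the isolated index with its value, up to a small error. -/
theorem prob_decode_ne_le (V : ℕ) (hV : 2 * V < p) (U : J → A → Prop) (x : Fin n → ℤ)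
    (hx : ∀ i, |x i| ≤ (V : ℤ)) :
    prob (fun ω : J → Fin n → A × ZMod p =>
      decode V U ω (fun j => counter (U j) (ω j) x)
        ≠ (isolatedIndex (fun j q => U j q.1) {i | x i ≠ 0} ω).map fun i => (i, x i))
      ≤ Fintype.card J * (n * (2 * V + 1)) / p := by
  classical
  have h1 : prob (fun ω : J → Fin n → A × ZMod p =>
      decode V U ω (fun j => counter (U j) (ω j) x)
        ≠ (isolatedIndex (fun j q => U j q.1) {i | x i ≠ 0} ω).map fun i => (i, x i))
      ≤ prob (fun ω : J → Fin n → A × ZMod p => ∃ q : J × Fin n × Set.Icc (-V : ℤ) V,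
        Collision (U q.1) (x - Pi.single q.2.1 (q.2.2 : ℤ)) (ω q.1)) := by
    refine prob_mono fun ω hω => ?_
    by_contra hno
    push Not at hno
    apply hω
    unfold decode isolatedIndex
    rw [← select_map]
    congr 1
    funext j
    exact decodeTest_counter V (U j) (ω j) x hx fun i v hv => hno (j, i, ⟨v, abs_le.1 hv⟩)
  refine h1.trans ((prob_exists_le _).trans ?_)
  have h2 : ∀ q : J × Fin n × Set.Icc (-V : ℤ) V,
      prob (fun ω : J → Fin n → A × ZMod p =>
        Collision (U q.1) (x - Pi.single q.2.1 (q.2.2 : ℤ)) (ω q.1)) ≤ 1 / p := by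
    rintro ⟨j, i, v, hv⟩
    have ha := prob_apply (ι := J) (W := Fin n → A × ZMod p) j
      (Collision (U j) (x - Pi.single i v))
    dsimp only
    rw [ha]
    refine prob_collision_le _ _ fun k hk => ?_
    rw [ZMod.intCast_zmod_eq_zero_iff_dvd] at hk
    -- Entries of the difference vector are at most 2V < p in absolute value, so they vanish mod p
    -- only if they are zero.
    apply Int.eq_zero_of_abs_lt_dvd hk
    refine (abs_sub_single_le V x hx i (abs_le.2 hv) k).trans_lt ?_
    exact_mod_cast hV
  refine (Finset.sum_le_sum fun q _ => h2 q).trans ?_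
  rw [Finset.sum_const, Finset.card_univ, nsmul_eq_mul, mul_one_div]
  apply le_of_eq
  congr 1
  rw [Fintype.card_prod, Fintype.card_prod, Fintype.card_fin, card_Icc_neg]
  push_cast
  ring

end Decode

/-! ### Independent copies and the exact law of rejection sampling -/

section IndepDraws

/-- Independent copies stay independent when each is advanced with its own coins; this reduces the
product algorithm to independent runs of `B`. -/
theorem indepDraws_bind {α β : Type} {R : ℕ} (p : Fin R → PMF α) (q : Fin R → α → PMF β) :
    (indepDraws p).bind (fun σ => indepDraws fun r => q r (σ r))
      = indepDraws fun r => (p r).bind (q r) := by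
  induction R with
  | zero => simp [indepDraws]
  | succ R ih =>
    simp only [indepDraws, PMF.bind_bind, PMF.bind_map, ← ih, PMF.map_bind]
    congr 1
    funext a
    simp only [Function.comp_def, Fin.cons_zero, Fin.cons_succ]
    rw [PMF.bind_comm]

variable {n : ℕ}

theorem rejectionSampler_run (B : StreamAlg n (Option (Fin n × ℤ))) (G : ℝ → ℝ) (H : ℝ) (R : ℕ)
    (s : List (Fin n × ℤ)) :
    (rejectionSampler B G H R).run s = indepDraws fun _ : Fin R => B.run s := by
  have h : ∀ p : PMF B.State,
      s.foldl (fun p u => p.bind fun σ => indepDraws fun r => B.step (σ r) u)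
        (indepDraws fun _ : Fin R => p)
      = indepDraws fun _ : Fin R => s.foldl (fun p u => p.bind fun σ => B.step σ u) p := by
    induction s with
    | nil => intro p; rfl
    | cons u s ih =>
      intro p
      rw [List.foldl_cons, indepDraws_bind (fun _ => p) (fun _ σ => B.step σ u), ih]
      rfl
  exact h B.init

theorem rejectionSampler_output (B : StreamAlg n (Option (Fin n × ℤ))) (G : ℝ → ℝ) (H : ℝ) (R : ℕ)
    (s : List (Fin n × ℤ)) :
    (rejectionSampler B G H R).output s
      = (indepDraws fun _ : Fin R => B.output s).bind fun o => firstAccepted G H (List.ofFn o) := by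
  unfold StreamAlg.output
  rw [rejectionSampler_run, ← indepDraws_bind, PMF.bind_bind]
  rfl

/-- Accept or reject a single sample. -/
noncomputable def acceptStep (G : ℝ → ℝ) (H : ℝ) : Option (Fin n × ℤ) → PMF (Option (Fin n))
  | none => PMF.pure none
  | some (i, v) =>
      (coin (acceptProb G H v) (min_le_left _ _)).map fun b => if b then some i else none

theorem firstAccepted_cons (G : ℝ → ℝ) (H : ℝ) (o : Option (Fin n × ℤ))
    (l : List (Option (Fin n × ℤ))) :
    firstAccepted G H (o :: l)
      = (acceptStep G H o).bind fun a => a.elim (firstAccepted G H l) fun i => PMF.pure (some i) := by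
  rcases o with _ | ⟨i, v⟩
  · simp [firstAccepted, acceptStep]
  · rw [firstAccepted, acceptStep, PMF.bind_map]
    congr 1
    funext b
    cases b <;> rfl

/-- The output of rejection sampling with `R` samples drawn from `p`. -/
noncomputable def firstAcceptedLaw (G : ℝ → ℝ) (H : ℝ) (p : PMF (Option (Fin n × ℤ))) (R : ℕ) :
    PMF (Option (Fin n)) :=
  (indepDraws fun _ : Fin R => p).bind fun o => firstAccepted G H (List.ofFn o)

theorem firstAcceptedLaw_succ (G : ℝ → ℝ) (H : ℝ) (p : PMF (Option (Fin n × ℤ))) (R : ℕ) :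
    firstAcceptedLaw G H p (R + 1) = (p.bind (acceptStep G H)).bind fun a =>
      a.elim (firstAcceptedLaw G H p R) fun i => PMF.pure (some i) := by
  unfold firstAcceptedLaw
  simp only [indepDraws, PMF.bind_bind, PMF.bind_map]
  congr 1
  funext o
  simp only [Function.comp_def, List.ofFn_cons, firstAccepted_cons]
  rw [PMF.bind_comm]
  congr 1
  funext a
  cases a with
  | none => rfl
  | some i => simp

theorem toReal_bind_elim_none {ι : Type} [Fintype ι] (q W : PMF (Option ι)) :
    ((q.bind fun a => a.elim W fun i => PMF.pure (some i)) none).toReal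
      = (q none).toReal * (W none).toReal := by
  classical
  rw [PMF.bind_apply, tsum_fintype, Fintype.sum_option]
  simp

theorem toReal_bind_elim_some {ι : Type} [Fintype ι] (q W : PMF (Option ι)) (i : ι) :
    ((q.bind fun a => a.elim W fun i => PMF.pure (some i)) (some i)).toReal
      = (q none).toReal * (W (some i)).toReal + (q (some i)).toReal := by
  classical
  rw [PMF.bind_apply, tsum_fintype, Fintype.sum_option, ENNReal.toReal_add, ENNReal.toReal_mul]
  · congr 2
    rw [Finset.sum_eq_single i]
    · simp
    · intro k _ hk
      simp [hk.symm]
    · simp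
  · exact ENNReal.mul_ne_top (PMF.apply_ne_top _ _) (PMF.apply_ne_top _ _)
  · exact ENNReal.sum_ne_top.2 fun _ _ =>
      ENNReal.mul_ne_top (PMF.apply_ne_top _ _) (PMF.apply_ne_top _ _)

theorem firstAcceptedLaw_none (G : ℝ → ℝ) (H : ℝ) (p : PMF (Option (Fin n × ℤ))) (R : ℕ) :
    (firstAcceptedLaw G H p R none).toReal = ((p.bind (acceptStep G H)) none).toReal ^ R := by
  induction R with
  | zero => simp [firstAcceptedLaw, indepDraws, firstAccepted]
  | succ R ih => rw [firstAcceptedLaw_succ, toReal_bind_elim_none, ih, pow_succ']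

/-- Index `i` is returned at the round preceded by r rejections, for some r < R. The geometric
factor does not depend on `i`, so it cancels after conditioning on success. -/
theorem firstAcceptedLaw_some (G : ℝ → ℝ) (H : ℝ) (p : PMF (Option (Fin n × ℤ))) (R : ℕ)
    (i : Fin n) :
    (firstAcceptedLaw G H p R (some i)).toReal
      = ((p.bind (acceptStep G H)) (some i)).toReal
        * ∑ r ∈ Finset.range R, ((p.bind (acceptStep G H)) none).toReal ^ r := by
  induction R with
  | zero => simp [firstAcceptedLaw, indepDraws, firstAccepted]
  | succ R ih =>
    rw [firstAcceptedLaw_succ, toReal_bind_elim_some, ih, Finset.sum_range_succ', mul_add,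
      pow_zero, mul_one]
    congr 1
    rw [mul_left_comm, Finset.mul_sum]
    simp only [pow_succ']

/-- Conditioned on success, rejection sampling returns an accepted sample. -/
theorem firstAcceptedLaw_cond (G : ℝ → ℝ) (H : ℝ) (p : PMF (Option (Fin n × ℤ))) {R : ℕ}
    (hR : R ≠ 0) (i : Fin n) :
    (firstAcceptedLaw G H p R (some i)).toReal / (1 - (firstAcceptedLaw G H p R none).toReal)
      = ((p.bind (acceptStep G H)) (some i)).toReal
        / (1 - ((p.bind (acceptStep G H)) none).toReal) := by
  rw [firstAcceptedLaw_none, firstAcceptedLaw_some]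
  set b := ((p.bind (acceptStep G H)) none).toReal
  have hb : 0 ≤ b := ENNReal.toReal_nonneg
  have hS : 0 < ∑ r ∈ Finset.range R, b ^ r := by
    refine Finset.sum_pos' (fun r _ => pow_nonneg hb r) ⟨0, ?_, by simp⟩
    simpa using Nat.pos_of_ne_zero hR
  rw [← geom_sum_mul_neg, mul_comm _ (1 - b), mul_div_mul_right _ _ hS.ne']

end IndepDraws

/-! ### Approximately uniform samples and thinning -/

section Laws

variable {n : ℕ}

theorem one_sub_toReal_none {ι : Type} [Fintype ι] (q : PMF (Option ι)) :
    1 - (q none).toReal = ∑ i, (q (some i)).toReal := by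
  have h := q.tsum_coe
  rw [tsum_fintype, Fintype.sum_option] at h
  have h' := congrArg ENNReal.toReal h
  rw [ENNReal.toReal_add (PMF.apply_ne_top _ _)
    (ENNReal.sum_ne_top.2 fun _ _ => PMF.apply_ne_top _ _),
    ENNReal.toReal_sum fun _ _ => PMF.apply_ne_top _ _, ENNReal.toReal_one] at h'
  linarith

theorem toReal_uniform_bind {α β : Type} [Fintype α] [Nonempty α] (g : α → PMF β) (b : β) :
    (((PMF.uniformOfFintype α).bind g) b).toReal = (∑ r, (g r b).toReal) / Fintype.card α := by
  rw [PMF.bind_apply, tsum_fintype, ENNReal.toReal_sum, Finset.sum_div]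
  · refine Finset.sum_congr rfl fun r _ => ?_
    rw [ENNReal.toReal_mul, PMF.uniformOfFintype_apply, ENNReal.toReal_inv,
      ENNReal.toReal_natCast, mul_comm, div_eq_mul_inv]
  · exact fun r _ => ENNReal.mul_ne_top (PMF.apply_ne_top _ _) (PMF.apply_ne_top _ _)

/-- A randomized map that forgets the value of a sample, and may also drop the sample. -/
structure IsThinning (k : Option (Fin n × ℤ) → PMF (Option (Fin n))) : Prop where
  none_some : ∀ i, k none (some i) = 0
  some_some : ∀ i j v, j ≠ i → k (some (j, v)) (some i) = 0

theorem isThinning_forget :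
    IsThinning (n := n) fun o => PMF.pure (o.map Prod.fst) where
  none_some i := by simp
  some_some i j v h := by simp [h.symm]

theorem isThinning_acceptStep (G : ℝ → ℝ) (H : ℝ) : IsThinning (n := n) (acceptStep G H) where
  none_some i := by simp [acceptStep]
  some_some i j v h := by
    rw [acceptStep, PMF.map_apply, ENNReal.tsum_eq_zero]
    intro b
    cases b <;> simp [h.symm]

theorem acceptStep_some (G : ℝ → ℝ) (H : ℝ) (i : Fin n) (v : ℤ) :
    (acceptStep G H (some (i, v)) (some i)).toReal = acceptProb G H v := by
  rw [acceptStep, PMF.map_apply, tsum_fintype, Fintype.sum_bool]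
  simp [coin]

/-- `p` is, up to an error of order `ε`, the law of a uniform element of the support of `x`
together with its value, or of `none` with a small probability. -/
structure IsApproxUniform (ε : ℝ) (x : Fin n → ℤ) (p : PMF (Option (Fin n × ℤ))) : Prop where
  bind_apply : ∃ κ : ℝ, 199 / 200 ≤ κ * (Finset.univ.filter fun i => x i ≠ 0).card ∧
    ∀ k, IsThinning k → ∀ i, |((p.bind k) (some i)).toReal
      - κ * (if x i = 0 then 0 else (k (some (i, x i)) (some i)).toReal)| ≤ 3 * ε
  value : (p.toOuterMeasure {o | ∃ i v, o = some (i, v) ∧ v ≠ x i}).toReal ≤ 2 * ε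

/-- Compare the decoded and the ideal sample on the same seed: they contribute equally unless
decoding errs, and then differ by at most 1. -/
theorem abs_bind_thinning_sub_le {Ω : Type} [Fintype Ω] [Nonempty Ω]
    (D : Ω → Option (Fin n × ℤ)) (I : Ω → Option (Fin n)) (x : Fin n → ℤ)
    {k : Option (Fin n × ℤ) → PMF (Option (Fin n))} (hk : IsThinning k) (i : Fin n) :
    |((((PMF.uniformOfFintype Ω).map D).bind k) (some i)).toReal
      - prob (fun r => I r = some i) * (k (some (i, x i)) (some i)).toReal|
      ≤ prob (fun r => D r ≠ (I r).map fun i => (i, x i)) := by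
  classical
  have hN : (0 : ℝ) < Fintype.card Ω := by exact_mod_cast Fintype.card_pos
  have hle : ∀ o, (k o (some i)).toReal ≤ 1 := fun o =>
    ENNReal.toReal_le_of_le_ofReal zero_le_one (by simpa using PMF.coe_le_one _ _)
  have h0 : ∀ o, 0 ≤ (k o (some i)).toReal := fun o => ENNReal.toReal_nonneg
  rw [PMF.bind_map, toReal_uniform_bind, prob_eq_sum, prob_eq_sum, div_mul_eq_mul_div,
    ← sub_div, Finset.sum_mul, ← Finset.sum_sub_distrib, abs_div, abs_of_pos hN]
  gcongr
  refine (Finset.abs_sum_le_sum_abs _ _).trans (Finset.sum_le_sum fun r _ => ?_)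
  simp only [Function.comp_apply]
  by_cases hD : D r = (I r).map fun i => (i, x i)
  · rw [if_neg (not_not.2 hD), hD]
    apply le_of_eq
    rw [abs_eq_zero]
    rcases hI : I r with _ | j
    · simp [hk.none_some]
    · by_cases hj : j = i
      · simp [hj]
      · simp [hj, hk.some_some i j (x j) hj]
  · rw [if_pos hD, abs_le]
    have := h0 (D r)
    have := h0 (some (i, x i))
    have := hle (D r)
    have := hle (some (i, x i))
    split_ifs <;> constructor <;> linarith

theorem isApproxUniform_of_uniform {Ω : Type} [Fintype Ω] [Nonempty Ω]
    (D : Ω → Option (Fin n × ℤ)) (I : Ω → Option (Fin n)) (x : Fin n → ℤ) {ε f : ℝ}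
    (hx : x ≠ 0) (hf : f ≤ 1 / 200) (hI : ∀ r i, I r = some i → x i ≠ 0)
    (hprob : ∀ i, x i ≠ 0 → |prob (fun r => I r = some i)
      - (1 - f) / (Finset.univ.filter fun i => x i ≠ 0).card| ≤ ε)
    (hD : prob (fun r => D r ≠ (I r).map fun i => (i, x i)) ≤ 2 * ε) :
    IsApproxUniform ε x ((PMF.uniformOfFintype Ω).map D) where
  bind_apply := by
    classical
    have hT : (Finset.univ.filter fun i => x i ≠ 0).Nonempty := by
      obtain ⟨i, hi⟩ := Function.ne_iff.1 hx
      exact ⟨i, by simpa using hi⟩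
    have hT' : ((Finset.univ.filter fun i => x i ≠ 0).card : ℝ) ≠ 0 := by
      exact_mod_cast hT.card_pos.ne'
    have hε : 0 ≤ ε := by linarith [(prob_nonneg _).trans hD]
    -- κ is the ideal probability of each support element. The error 3ε is 2ε from decoding plus ε
    -- from the law of the index.
    refine ⟨(1 - f) / (Finset.univ.filter fun i => x i ≠ 0).card, ?_, fun k hk i => ?_⟩
    · rw [div_mul_cancel₀ _ hT']; linarith
    · have h1 := abs_bind_thinning_sub_le D I x hk i
      have hg0 : 0 ≤ (k (some (i, x i)) (some i)).toReal := ENNReal.toReal_nonneg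
      have hg1 : (k (some (i, x i)) (some i)).toReal ≤ 1 :=
        ENNReal.toReal_le_of_le_ofReal zero_le_one (by simpa using PMF.coe_le_one _ _)
      split_ifs with hxi
      · have h2 : prob (fun r => I r = some i) = 0 := by
          rw [prob_eq_card, Finset.filter_eq_empty_iff.2 fun r _ h => hI r i h hxi]
          simp
        rw [h2, zero_mul] at h1
        rw [mul_zero]
        linarith
      · have h2 := hprob i hxi
        have h3 := abs_sub_le (((((PMF.uniformOfFintype Ω).map D).bind k) (some i)).toReal)
          (prob (fun r => I r = some i) * (k (some (i, x i)) (some i)).toReal)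
          ((1 - f) / (Finset.univ.filter fun i => x i ≠ 0).card
            * (k (some (i, x i)) (some i)).toReal)
        rw [← sub_mul, abs_mul, abs_of_nonneg hg0] at h3
        have h4 := mul_le_mul h2 hg1 hg0 hε
        linarith
  value := by
    classical
    refine le_trans ?_ hD
    rw [PMF.toOuterMeasure_map_apply, PMF.toOuterMeasure_uniformOfFintype_apply, prob_eq_card,
      ENNReal.toReal_div, ENNReal.toReal_natCast, ENNReal.toReal_natCast]
    gcongr
    rw [Fintype.card_subtype]
    refine Finset.card_le_card fun r hr => ?_
    simp only [Finset.mem_filter, Finset.mem_univ, true_and] at hr ⊢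
    obtain ⟨i, v, h1, h2⟩ := hr
    intro h3
    rw [h3] at h1
    rcases hI' : I r with _ | j
    · simp [hI'] at h1
    · rw [hI'] at h1
      simp only [Option.map_some, Option.some.injEq, Prod.mk.injEq] at h1
      exact h2 (by rw [← h1.2, h1.1])

/-- Normalising removes the scale κ: the error in P_i and the error in the total each contribute,
the latter being at most nδ. -/
theorem abs_div_sum_sub_div_sum_le (P g : Fin n → ℝ) {κ δ : ℝ} (hP : 0 < ∑ i, P i)
    (hg : ∀ i, 0 ≤ g i) (hgs : 0 < ∑ i, g i) (h : ∀ i, |P i - κ * g i| ≤ δ) (i : Fin n) :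
    |P i / ∑ j, P j - g i / ∑ j, g j| ≤ (n + 1) * δ / ∑ j, P j := by
  have h1 : |κ * ∑ j, g j - ∑ j, P j| ≤ n * δ := by
    rw [Finset.mul_sum, ← Finset.sum_sub_distrib]
    refine (Finset.abs_sum_le_sum_abs _ _).trans ?_
    refine (Finset.sum_le_sum fun j _ => (abs_sub_comm _ _).trans_le (h j)).trans ?_
    simp
  have h2 : P i / ∑ j, P j - g i / ∑ j, g j
      = ((P i - κ * g i) + g i / (∑ j, g j) * (κ * ∑ j, g j - ∑ j, P j)) / ∑ j, P j := by
    field_simp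
    ring
  have h3 : g i / (∑ j, g j) ≤ 1 :=
    div_le_one_of_le₀ (Finset.single_le_sum (fun j _ => hg j) (Finset.mem_univ i)) hgs.le
  have h4 : 0 ≤ g i / (∑ j, g j) := div_nonneg (hg i) hgs.le
  rw [h2, abs_div, abs_of_pos hP]
  gcongr
  refine (abs_add_le _ _).trans ?_
  rw [abs_mul, abs_of_nonneg h4]
  have h5 := mul_le_mul h3 h1 (abs_nonneg _) zero_le_one
  linarith [h i]

/-- Thinning an approximately uniform sample: the success probability, and the law of the index
conditioned on success. -/
theorem IsApproxUniform.thinning {ε : ℝ} {x : Fin n → ℤ} {p : PMF (Option (Fin n × ℤ))}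
    (hp : IsApproxUniform ε x p) {k : Option (Fin n × ℤ) → PMF (Option (Fin n))}
    (hk : IsThinning k) {g : Fin n → ℝ}
    (hgk : ∀ i, g i = if x i = 0 then 0 else (k (some (i, x i)) (some i)).toReal) {b : ℝ}
    (hb : 0 ≤ b) (hgb : ∀ i, x i ≠ 0 → b ≤ g i) (hε : 3 * n * ε < 199 / 200 * b) :
    199 / 200 * b - 3 * n * ε ≤ 1 - ((p.bind k) none).toReal ∧
    ∀ i, |((p.bind k) (some i)).toReal / (1 - ((p.bind k) none).toReal) - g i / ∑ j, g j|
      ≤ (n + 1) * (3 * ε) / (199 / 200 * b - 3 * n * ε) := by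
  classical
  obtain ⟨κ, hκ, h⟩ := hp.bind_apply
  have h1 := h k hk
  simp only [← hgk] at h1
  have hg : ∀ i, 0 ≤ g i := by
    intro i
    by_cases hi : x i = 0
    · simp [hgk, hi]
    · exact hb.trans (hgb i hi)
  have hsum : (Finset.univ.filter fun i => x i ≠ 0).card * b ≤ ∑ i, g i := by
    rw [← nsmul_eq_mul, ← Finset.sum_const]
    exact (Finset.sum_le_sum fun i hi => hgb i (by simpa using hi)).trans
      (Finset.sum_le_sum_of_subset_of_nonneg (Finset.subset_univ _) fun i _ _ => hg i)
  have hκ0 : 0 ≤ κ := by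
    by_contra hneg
    push Not at hneg
    have := mul_nonpos_of_nonpos_of_nonneg hneg.le
      (Nat.cast_nonneg (α := ℝ) (Finset.univ.filter fun i => x i ≠ 0).card)
    linarith
  have hdiff : |∑ i, ((p.bind k) (some i)).toReal - κ * ∑ i, g i| ≤ 3 * n * ε := by
    rw [Finset.mul_sum, ← Finset.sum_sub_distrib]
    refine (Finset.abs_sum_le_sum_abs _ _).trans ((Finset.sum_le_sum fun i _ => h1 i).trans ?_)
    rw [Finset.sum_const, Finset.card_univ, Fintype.card_fin, nsmul_eq_mul]
    linarith
  have hlow : 199 / 200 * b ≤ κ * ∑ i, g i := by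
    calc 199 / 200 * b ≤ κ * (Finset.univ.filter fun i => x i ≠ 0).card * b := by gcongr
      _ = κ * ((Finset.univ.filter fun i => x i ≠ 0).card * b) := by ring
      _ ≤ _ := by gcongr
  rw [one_sub_toReal_none]
  have hP : 199 / 200 * b - 3 * n * ε ≤ ∑ i, ((p.bind k) (some i)).toReal := by
    linarith [(abs_le.1 hdiff).1]
  have hpos : 0 < 199 / 200 * b - 3 * n * ε := by linarith
  have hε0 : 0 ≤ n * ε := by nlinarith [(abs_nonneg _).trans hdiff]
  refine ⟨hP, fun i => ?_⟩
  have hgs : 0 < ∑ i, g i := by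
    by_contra hneg
    have : κ * ∑ i, g i ≤ 0 := mul_nonpos_of_nonneg_of_nonpos hκ0 (not_lt.1 hneg)
    nlinarith
  refine (abs_div_sum_sub_div_sum_le _ g (hpos.trans_le hP) hg hgs h1 i).trans ?_
  have h0 : 0 ≤ 3 * ε := (abs_nonneg _).trans (h1 i)
  gcongr

end Laws

/-! ### Sampling rates and a short list of good seeds -/

section Seeds

/-- The lowest sampling rate in use is `2 ^ (-topLevel n)`. -/
abbrev topLevel (n : ℕ) : ℕ := Nat.log 2 n + 2

/-- There are 40 tests for each sampling rate. -/
abbrev TestIndex (n : ℕ) : Type := Fin (topLevel n + 1) × Fin 40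

/-- A uniform element of `Fin (2 ^ topLevel n)` is sampled at level `l` with
probability `2 ^ (-l)`. -/
def Sampled (n : ℕ) (l : Fin (topLevel n + 1)) (a : Fin (2 ^ topLevel n)) : Prop :=
  a.val < 2 ^ (topLevel n - l)

theorem prob_fst {A B : Type*} [Fintype A] [Fintype B] [Nonempty B] (U : A → Prop) :
    prob (fun q : A × B => U q.1) = prob U := by
  classical
  have hB : (Fintype.card B : ℝ) ≠ 0 := by exact_mod_cast Fintype.card_ne_zero
  have : (Finset.univ.filter fun q : A × B => U q.1) = (Finset.univ.filter U) ×ˢ Finset.univ := by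
    ext q; simp
  rw [prob_eq_card, prob_eq_card, this, Finset.card_product, Fintype.card_prod, Finset.card_univ]
  push_cast
  rw [mul_div_mul_right _ _ hB]

theorem prob_sampled (n : ℕ) (l : Fin (topLevel n + 1)) :
    prob (Sampled n l) = 1 / 2 ^ (l : ℕ) := by
  classical
  have hl : (l : ℕ) ≤ topLevel n := Nat.lt_succ_iff.1 l.2
  have hc : (Finset.univ.filter (Sampled n l)).card = 2 ^ (topLevel n - l) := by
    have h : (Finset.univ.filter (Sampled n l)).map Fin.valEmbedding
        = Finset.range (2 ^ (topLevel n - l)) := by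
      ext a
      simp only [Finset.mem_map, Finset.mem_filter, Finset.mem_univ, true_and,
        Fin.valEmbedding_apply, Finset.mem_range, Sampled]
      constructor
      · rintro ⟨b, hb, rfl⟩; exact hb
      · intro ha
        exact ⟨⟨a, ha.trans_le (Nat.pow_le_pow_right two_pos (Nat.sub_le _ _))⟩, ha, rfl⟩
    rw [← Finset.card_map, h, Finset.card_range]
  rw [prob_eq_card, hc, Fintype.card_fin]
  push_cast
  rw [div_eq_div_iff (by positivity) (by positivity), one_mul, ← pow_add, Nat.sub_add_cancel hl]

theorem exists_level {n k : ℕ} (hk : 0 < k) (hkn : k ≤ n) :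
    ∃ l : Fin (topLevel n + 1), (1 : ℝ) / 4 ≤ k * prob (Sampled n l) ∧
      k * prob (Sampled n l) ≤ 1 / 2 := by
  -- From 2^(log k) ≤ k < 2^(log k + 1), the offset 2 puts k·2^(-l) in [1/4, 1/2].
  refine ⟨⟨Nat.log 2 k + 2, ?_⟩, ?_⟩
  · have := Nat.log_mono_right (b := 2) hkn
    simp only [topLevel]; omega
  · rw [prob_sampled]
    have h1 : (2 : ℝ) ^ Nat.log 2 k ≤ k := by exact_mod_cast Nat.pow_log_le_self 2 hk.ne'
    have h2 : (k : ℝ) < 2 ^ (Nat.log 2 k + 1) := by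
      exact_mod_cast Nat.lt_pow_succ_log_self one_lt_two k
    have h3 : (0 : ℝ) < 2 ^ Nat.log 2 k := by positivity
    simp only [pow_add, pow_one] at h2 ⊢
    rw [mul_one_div]
    constructor
    · rw [le_div_iff₀ (by positivity)]; linarith
    · rw [div_le_iff₀ (by positivity)]; linarith

/-- The result of the tests for the vector `x` with the random choices `ω`. -/
noncomputable def sketchDecode {n p : ℕ} (V : ℕ)
    (ω : TestIndex n → Fin n → Fin (2 ^ topLevel n) × ZMod p) (x : Fin n → ℤ) :
    Option (Fin n × ℤ) :=
  decode V (fun j : TestIndex n => Sampled n j.1) ω fun j => counter (Sampled n j.1) (ω j) x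

/-- A small number of seeds suffices for the tests to succeed on all vectors with small entries. -/
theorem exists_seeds {n V t p : ℕ} [Fact p.Prime] [NeZero t] (hV : 2 * V < p) {ε : ℝ}
    (hε : 0 ≤ ε) (hε1 : ε ≤ 1)
    (ht : 2 * ((2 * V + 1) ^ n * (n + 1) : ℝ) < Real.exp (ε ^ 2 * t / 4))
    (hp : ((topLevel n + 1) * 40 * (n * (2 * V + 1)) : ℝ) / p ≤ ε) :
    ∃ ω : Fin t → TestIndex n → Fin n → Fin (2 ^ topLevel n) × ZMod p,
      ∀ x : Fin n → ℤ, (∀ i, |x i| ≤ (V : ℤ)) → x ≠ 0 →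
        IsApproxUniform ε x
          ((PMF.uniformOfFintype (Fin t)).map fun r => sketchDecode V (ω r) x) := by
  classical
  let U : TestIndex n → Fin (2 ^ topLevel n) × ZMod p → Prop := fun j q => Sampled n j.1 q.1
  let I : (Fin n → ℤ) → (TestIndex n → Fin n → Fin (2 ^ topLevel n) × ZMod p) → Option (Fin n) :=
    fun x ω => isolatedIndex U {i | x i ≠ 0} ω
  -- For each vector there are n + 1 events to approximate: `none` stands for a decoding error,
  -- `some i` for isolating `i`.
  let E : (Fin n → Set.Icc (-V : ℤ) V) × Option (Fin n) →
      (TestIndex n → Fin n → Fin (2 ^ topLevel n) × ZMod p) → Prop := fun e ω =>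
    e.2.elim (sketchDecode V ω (fun i => (e.1 i : ℤ))
        ≠ (I (fun i => (e.1 i : ℤ)) ω).map fun i => (i, (e.1 i : ℤ)))
      fun i => I (fun i => (e.1 i : ℤ)) ω = some i
  obtain ⟨ω, hω⟩ := exists_sample E hε hε1 t (NeZero.pos t) (by
    rw [Fintype.card_prod, Fintype.card_pi, Finset.prod_const, Finset.card_univ, card_Icc_neg,
      Fintype.card_option, Fintype.card_fin]
    exact_mod_cast ht)
  refine ⟨ω, fun x hx hx0 => ?_⟩
  have hT : ({i | x i ≠ 0} : Set (Fin n)) = (Finset.univ.filter fun i => x i ≠ 0 : Finset _) := by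
    ext i; simp
  obtain ⟨i₀, hi₀⟩ := Function.ne_iff.1 hx0
  have hcard : 0 < (Finset.univ.filter fun i => x i ≠ 0).card :=
    Finset.card_pos.2 ⟨i₀, by simpa using hi₀⟩
  obtain ⟨l, hl1, hl2⟩ := exists_level hcard ((Finset.card_le_univ _).trans_eq (Fintype.card_fin n))
  rw [← prob_fst (B := ZMod p)] at hl1 hl2
  have hf := prob_isolatedIndex_eq_none_le (κ := Fin 40)
    (fun l (q : Fin (2 ^ topLevel n) × ZMod p) => Sampled n l q.1) _ l hl1 hl2
  rw [← hT, Fintype.card_fin] at hf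
  have hx' : ∀ i, x i ∈ Set.Icc (-V : ℤ) V := fun i => abs_le.1 (hx i)
  refine isApproxUniform_of_uniform _ (fun r => I x (ω r)) x (f := prob fun ω => I x ω = none)
    hx0 (hf.trans (by norm_num)) (fun r i h => isolatedIndex_mem h) (fun i hi => ?_) ?_
  · have h1 := hω (fun i => ⟨x i, hx' i⟩, some i)
    have h2 := prob_isolatedIndex U (Finset.univ.filter fun i => x i ≠ 0)
      (i := i) (by simpa using hi)
    rw [← hT] at h2
    rw [← h2]
    exact h1
  · have h1 := hω (fun i => ⟨x i, hx' i⟩, none)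
    have h2 := prob_decode_ne_le (p := p) V hV (fun j : TestIndex n => Sampled n j.1) x hx
    rw [Fintype.card_prod, Fintype.card_fin, Fintype.card_fin] at h2
    simp only [topLevel] at hp
    push_cast at h2 hp
    have h3 := h2.trans hp
    have h4 := (abs_le.1 h1).2
    change prob (fun r => sketchDecode V (ω r) x ≠ (I x (ω r)).map fun i => (i, x i))
      - prob (fun ω => sketchDecode V ω x ≠ (I x ω).map fun i => (i, x i)) ≤ ε at h4
    change prob (fun ω => sketchDecode V ω x ≠ (I x ω).map fun i => (i, x i)) ≤ ε at h3
    linarith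

end Seeds

/-! ### The linear sketch as a streaming algorithm -/

section SketchAlg

variable {n : ℕ}

theorem freq_nil : freq ([] : List (Fin n × ℤ)) = 0 := by
  funext i; simp [freq]

theorem freq_cons (u : Fin n × ℤ) (s : List (Fin n × ℤ)) :
    freq (u :: s) = Pi.single u.1 u.2 + freq s := by
  funext i
  by_cases h : u.1 = i
  · subst h; simp [freq]
  · simp [freq, h]

theorem abs_freq_le {m M : ℕ} {s : List (Fin n × ℤ)} (hs : IsTurnstileStream m M s) (i : Fin n) :
    |freq s i| ≤ (m * M : ℕ) := by
  have h : ∀ s : List (Fin n × ℤ), (∀ u ∈ s, |u.2| ≤ (M : ℤ)) → |freq s i| ≤ s.length * M := by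
    intro s
    induction s with
    | nil => intro _; simp [freq_nil]
    | cons u s ih =>
      intro h
      rw [freq_cons, Pi.add_apply, List.length_cons]
      have h1 := ih fun v hv => h v (List.mem_cons_of_mem _ hv)
      have h2 := h u List.mem_cons_self
      have h3 : |(Pi.single u.1 u.2 : Fin n → ℤ) i| ≤ (M : ℤ) := by
        by_cases hi : i = u.1
        · rw [hi]; simpa using h2
        · simp [hi]
      have := abs_add_le ((Pi.single u.1 u.2 : Fin n → ℤ) i) (freq s i)
      push_cast
      linarith
  refine (h s hs.2).trans ?_
  push_cast
  have := hs.1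
  gcongr

/-- The linear sketch: choose a seed at random, and maintain the counters of all tests. -/
noncomputable def sketchAlg {p t : ℕ} [NeZero p] [NeZero t] (V : ℕ)
    (ω : Fin t → TestIndex n → Fin n → Fin (2 ^ topLevel n) × ZMod p) :
    StreamAlg n (Option (Fin n × ℤ)) where
  State := Fin t × (TestIndex n → ZMod p)
  finite_state := inferInstance
  init := (PMF.uniformOfFintype (Fin t)).map fun r => (r, 0)
  step σ u := PMF.pure (σ.1, σ.2 + fun j => weight (Sampled n j.1) (ω σ.1 j) u.1 * u.2)
  out σ := PMF.pure (decode V (fun j : TestIndex n => Sampled n j.1) (ω σ.1) σ.2)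

theorem counter_single_add {A : Type*} {p : ℕ} (U : A → Prop) (w : Fin n → A × ZMod p)
    (u : Fin n × ℤ) (x : Fin n → ℤ) :
    counter U w (Pi.single u.1 u.2 + x) = weight U w u.1 * u.2 + counter U w x := by
  have h := counter_sub_single U w x u.1 (-u.2)
  rw [Pi.single_neg, sub_neg_eq_add, add_comm] at h
  rw [h]
  push_cast
  ring

/-- Counters are linear in the vector, so updates can be applied one by one. The induction needs
arbitrary initial counters depending on the seed. -/
theorem sketchAlg_output {p t : ℕ} [NeZero p] [NeZero t] (V : ℕ)
    (ω : Fin t → TestIndex n → Fin n → Fin (2 ^ topLevel n) × ZMod p) (s : List (Fin n × ℤ)) :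
    (sketchAlg V ω).output s
      = (PMF.uniformOfFintype (Fin t)).map fun r => sketchDecode V (ω r) (freq s) := by
  have h : ∀ F : Fin t → TestIndex n → ZMod p,
      s.foldl (fun (q : PMF (Fin t × (TestIndex n → ZMod p))) u => q.bind fun σ =>
          PMF.pure (σ.1, σ.2 + fun j => weight (Sampled n j.1) (ω σ.1 j) u.1 * u.2))
        ((PMF.uniformOfFintype (Fin t)).map fun r => (r, F r))
      = (PMF.uniformOfFintype (Fin t)).map fun r =>
        (r, F r + fun j => counter (Sampled n j.1) (ω r j) (freq s)) := by
    induction s with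
    | nil =>
      intro F
      have : ∀ r, (fun j : TestIndex n => counter (Sampled n j.1) (ω r j) 0) = 0 := by
        intro r; funext j; simp [counter]
      simp [freq_nil, this]
    | cons u s ih =>
      intro F
      have h1 := ih fun r => F r + fun j => weight (Sampled n j.1) (ω r j) u.1 * u.2
      rw [List.foldl_cons, PMF.bind_map]
      refine Eq.trans h1 ?_
      congr 1
      funext r
      rw [freq_cons, add_assoc]
      congr 2
      funext j
      exact (counter_single_add _ _ _ _).symm
  have h1 := h 0
  simp only [Pi.zero_apply, zero_add] at h1
  unfold StreamAlg.output StreamAlg.run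
  refine (congrArg (fun q => PMF.bind q (sketchAlg V ω).out) h1).trans ?_
  exact PMF.bind_map (PMF.uniformOfFintype (Fin t)) (fun r =>
    (r, fun j : TestIndex n => counter (Sampled n j.1) (ω r j) (freq s))) (sketchAlg V ω).out

theorem card_sketchAlg_state {p t : ℕ} [NeZero p] [NeZero t] (V : ℕ)
    (ω : Fin t → TestIndex n → Fin n → Fin (2 ^ topLevel n) × ZMod p) :
    Nat.card (sketchAlg V ω).State = t * p ^ ((topLevel n + 1) * 40) := by
  change Nat.card (Fin t × (TestIndex n → ZMod p)) = _
  simp [Nat.card_eq_fintype_card, ZMod.card]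

end SketchAlg

/-! ### Storing the stream, for large H/Q -/

section StoreAlg

variable {n : ℕ}

/-- A stream is encoded as a word of length exactly `m` padded with `none`, which accounts for the
extra letter. -/
theorem finite_turnstile (n m M : ℕ) :
    Finite {s : List (Fin n × ℤ) // IsTurnstileStream m M s} ∧
    Nat.card {s : List (Fin n × ℤ) // IsTurnstileStream m M s} ≤ (n * (2 * M + 1) + 1) ^ m := by
  classical
  let f : {s : List (Fin n × ℤ) // IsTurnstileStream m M s} →
      (Fin m → Option (Fin n × Set.Icc (-M : ℤ) M)) := fun s i =>
    if h : (i : ℕ) < s.1.length then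
      some (s.1[(i : ℕ)].1, ⟨s.1[(i : ℕ)].2, abs_le.1 (s.2.2 _ (List.getElem_mem h))⟩)
    else none
  have hf : Function.Injective f := by
    have hget : ∀ s : {s : List (Fin n × ℤ) // IsTurnstileStream m M s}, ∀ k (hk : k < m),
        s.1[k]? = (f s ⟨k, hk⟩).map fun q => (q.1, (q.2 : ℤ)) := by
      intro s k hk
      simp only [f]
      split_ifs with h
      · rw [List.getElem?_eq_getElem h]; rfl
      · rw [List.getElem?_eq_none (not_lt.1 h)]; rfl
    intro s s' h
    apply Subtype.ext
    apply List.ext_getElem?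
    intro k
    by_cases hk : k < m
    · rw [hget s k hk, hget s' k hk, h]
    · rw [List.getElem?_eq_none (s.2.1.trans (not_lt.1 hk)),
        List.getElem?_eq_none (s'.2.1.trans (not_lt.1 hk))]
  refine ⟨Finite.of_injective f hf, (Nat.card_le_card_of_injective f hf).trans_eq ?_⟩
  rw [Nat.card_eq_fintype_card, Fintype.card_pi, Finset.prod_const, Fintype.card_option,
    Fintype.card_prod, card_Icc_neg, Finset.card_univ, Fintype.card_fin, Fintype.card_fin]

open Classical in
/-- Store the whole stream, and compute the output from it. -/
noncomputable def storeAlg {Out : Type} (m M : ℕ) (q : List (Fin n × ℤ) → PMF Out) :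
    StreamAlg n Out where
  State := {s : List (Fin n × ℤ) // IsTurnstileStream m M s}
  finite_state := (finite_turnstile n m M).1
  init := PMF.pure ⟨[], by simp [IsTurnstileStream]⟩
  -- The fallback is never used on a valid stream, as all its prefixes are valid.
  step s u := PMF.pure (if h : IsTurnstileStream m M (s.1 ++ [u]) then ⟨s.1 ++ [u], h⟩ else s)
  out s := q s.1

theorem storeAlg_run {Out : Type} (m M : ℕ) (q : List (Fin n × ℤ) → PMF Out)
    (s : List (Fin n × ℤ)) (hs : IsTurnstileStream m M s) :
    (storeAlg m M q).run s = PMF.pure (⟨s, hs⟩ : {s // IsTurnstileStream m M s}) := by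
  induction s using List.reverseRecOn with
  | nil => rfl
  | append_singleton s u ih =>
    have hs' : IsTurnstileStream m M s :=
      ⟨le_trans (by simp) hs.1, fun v hv => hs.2 v (List.mem_append_left _ hv)⟩
    have h1 := ih hs'
    unfold StreamAlg.run at h1 ⊢
    rw [List.foldl_concat, h1]
    refine (PMF.pure_bind _ _).trans ?_
    simp only [storeAlg, dif_pos hs]

theorem storeAlg_output {Out : Type} (m M : ℕ) (q : List (Fin n × ℤ) → PMF Out)
    (s : List (Fin n × ℤ)) (hs : IsTurnstileStream m M s) :
    (storeAlg m M q).output s = q s := by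
  unfold StreamAlg.output
  rw [storeAlg_run m M q s hs]
  exact PMF.pure_bind _ _

theorem exists_isPerfectSample {G : ℝ → ℝ} (hG : ∀ z, 0 ≤ G z) {δ c : ℝ} (hδ : 0 ≤ δ)
    (x : Fin n → ℤ) (hx : 0 < ∑ i, G (x i)) :
    ∃ p, IsPerfectSample G δ c x p := by
  classical
  refine ⟨PMF.ofFintype (fun o : Option (Fin n) =>
    o.elim 0 fun i => ENNReal.ofReal (G (x i) / ∑ j, G (x j))) ?_, ?_, fun i => ?_⟩
  · rw [Fintype.sum_option]
    simp only [Option.elim_none, Option.elim_some, zero_add]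
    rw [← ENNReal.ofReal_sum_of_nonneg fun i _ => div_nonneg (hG _) hx.le, ← Finset.sum_div,
      div_self hx.ne', ENNReal.ofReal_one]
  · simpa using hδ
  · simp only [PMF.ofFintype_apply, Option.elim_none, Option.elim_some]
    rw [ENNReal.toReal_ofReal (div_nonneg (hG _) hx.le)]
    simp only [ENNReal.toReal_zero, sub_zero, div_one, sub_self, abs_zero]
    positivity

end StoreAlg

/-! ### From approximately uniform to perfect samples -/

section Perfect

variable {n : ℕ}

/-- An approximately uniform sample is a perfect `L_0`-sample. -/
theorem IsApproxUniform.isPerfectL0Sample {ε c : ℝ} {x : Fin n → ℤ}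
    {p : PMF (Option (Fin n × ℤ))} (hp : IsApproxUniform ε x p) (hn : 2 ≤ n) (hc : 0 < c)
    (hε0 : 0 ≤ ε) (hε : 600 * (n + 1) * ε ≤ (n : ℝ) ^ (-c)) :
    IsPerfectL0Sample (1 / 100) c x p := by
  have hn' : (2 : ℝ) ≤ n := by exact_mod_cast hn
  have hc1 : (n : ℝ) ^ (-c) ≤ 1 := Real.rpow_le_one_of_one_le_of_nonpos (by linarith) (by linarith)
  have hnε : 0 ≤ n * ε := by positivity
  have h := hp.thinning isThinning_forget (g := fun i => if ((x i : ℤ) : ℝ) = 0 then 0 else 1)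
    (fun i => by simp) zero_le_one (fun i hi => by simp [hi]) (by nlinarith)
  obtain ⟨h1, h2⟩ := h
  have hmap : p.map (Option.map Prod.fst) = p.bind fun o => PMF.pure (o.map Prod.fst) := rfl
  refine ⟨⟨?_, fun i => ?_⟩, hp.value.trans (by nlinarith)⟩
  · rw [hmap]
    linarith
  · rw [hmap]
    refine (h2 i).trans ((div_le_iff₀ (by linarith)).2 ?_)
    nlinarith

theorem acceptProb_of_le {G : ℝ → ℝ} {H : ℝ} {v : ℤ} (h0 : 0 ≤ G v) (hH : 0 < H)
    (h : G v ≤ H) : (acceptProb G H v : ℝ) = G v / H := by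
  rw [acceptProb, NNReal.coe_min, NNReal.coe_one, Real.coe_toNNReal _ (div_nonneg h0 hH.le),
    min_eq_right ((div_le_one hH).2 h)]

/-- Rejection sampling turns approximately uniform samples into a perfect `G`-sample. -/
theorem IsApproxUniform.isPerfectSample_firstAcceptedLaw {ε c : ℝ} {x : Fin n → ℤ}
    {p : PMF (Option (Fin n × ℤ))} (hp : IsApproxUniform ε x p) (hn : 2 ≤ n) (hc : 0 < c)
    (hε0 : 0 ≤ ε) {G : ℝ → ℝ} {Q H : ℝ} (hG : ∀ z, 0 ≤ G z) (hG0 : G 0 = 0) (hQ : 0 < Q)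
    (hQH : Q ≤ H) (hx : ∀ i, x i ≠ 0 → Q ≤ G (x i) ∧ G (x i) ≤ H)
    (hε : 600 * (n + 1) * ε * (H / Q) ≤ (n : ℝ) ^ (-c)) {R : ℕ} (hR : 10 * (H / Q) ≤ R) :
    IsPerfectSample G (1 / 100) c x (firstAcceptedLaw G H p R) := by
  have hn' : (2 : ℝ) ≤ n := by exact_mod_cast hn
  have hH : 0 < H := hQ.trans_le hQH
  have hc1 : (n : ℝ) ^ (-c) ≤ 1 := Real.rpow_le_one_of_one_le_of_nonpos (by linarith) (by linarith)
  have hb : 0 < Q / H := div_pos hQ hH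
  have hHQ : H / Q = (Q / H)⁻¹ := (inv_div _ _).symm
  set b := Q / H with hbdef
  rw [hHQ] at hε hR
  have hεb : 600 * (n + 1) * ε ≤ b * (n : ℝ) ^ (-c) := by
    rw [← div_eq_mul_inv, div_le_iff₀ hb] at hε
    linarith
  have hεb' : 600 * (n + 1) * ε ≤ b := hεb.trans (mul_le_of_le_one_right hb.le hc1)
  have hnε : 0 ≤ n * ε := by positivity
  obtain ⟨h1, h2⟩ := hp.thinning (isThinning_acceptStep G H) (g := fun i => G (x i) / H)
    (fun i => by
      split_ifs with hi
      · simp [hi, hG0]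
      · rw [acceptStep_some, acceptProb_of_le (hG _) hH (hx i hi).2])
    hb.le (fun i hi => by rw [hbdef]; gcongr; exact (hx i hi).1) (by nlinarith)
  -- Each draw is accepted with probability at least b/2; since Rb ≥ 10, all `R` draws fail with
  -- probability at most e^(-5) < 1/100.
  have hhalf : b / 2 ≤ 199 / 200 * b - 3 * n * ε := by nlinarith
  have hR0 : R ≠ 0 := by
    rintro rfl
    have : 0 < 10 * b⁻¹ := by positivity
    push_cast at hR
    linarith
  refine ⟨?_, fun i => ?_⟩
  · rw [firstAcceptedLaw_none]
    set q := ((p.bind (acceptStep G H)) none).toReal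
    have hq0 : 0 ≤ q := ENNReal.toReal_nonneg
    have hq : q ≤ Real.exp (-(b / 2)) := by linarith [Real.add_one_le_exp (-(b / 2))]
    have hRb : 10 ≤ R * b := by rwa [← div_eq_mul_inv, div_le_iff₀ hb] at hR
    calc q ^ R ≤ Real.exp (-(b / 2)) ^ R := pow_le_pow_left₀ hq0 hq R
      _ = Real.exp (-(R * b / 2)) := by rw [← Real.exp_nat_mul]; congr 1; ring
      _ ≤ Real.exp (-5) := Real.exp_le_exp.2 (by linarith)
      _ ≤ 1 / 100 := by
        rw [Real.exp_neg, ← one_div]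
        apply one_div_le_one_div_of_le (by norm_num)
        have he := Real.exp_one_gt_d9
        have h5 : Real.exp 5 = Real.exp 1 ^ 5 := by rw [← Real.exp_nat_mul]; norm_num
        rw [h5]
        calc (100 : ℝ) ≤ 2.7 ^ 5 := by norm_num
          _ ≤ Real.exp 1 ^ 5 := pow_le_pow_left₀ (by norm_num) (by linarith) 5
  · rw [firstAcceptedLaw_cond G H p hR0]
    have h3 := h2 i
    rw [← Finset.sum_div, div_div_div_cancel_right₀ hH.ne'] at h3
    refine h3.trans ((div_le_iff₀ (by linarith)).2 ?_)
    have h4 := mul_le_mul_of_nonneg_right hhalf (Real.rpow_nonneg (Nat.cast_nonneg n) (-c))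
    rw [mul_comm ((n : ℝ) ^ (-c))]
    nlinarith

end Perfect

/-! ### Numerical estimates -/

section Numerics

variable {n : ℕ}

theorem half_le_log (hn : 2 ≤ n) : 1 / 2 ≤ Real.log n := by
  have h1 := Real.log_two_gt_d9
  have h2 : Real.log 2 ≤ Real.log n := Real.log_le_log two_pos (by exact_mod_cast hn)
  linarith

theorem natLog_le (hn : 2 ≤ n) : (Nat.log 2 n : ℝ) ≤ 2 * Real.log n := by
  have h1 := Real.log_two_gt_d9
  have h2 : (2 : ℝ) ^ Nat.log 2 n ≤ n := by
    exact_mod_cast Nat.pow_log_le_self 2 (by omega)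
  have h3 := Real.log_le_log (by positivity) h2
  rw [Real.log_pow] at h3
  have : (0 : ℝ) ≤ Nat.log 2 n := Nat.cast_nonneg _
  nlinarith

theorem clog_le_of_le_pow (hn : 2 ≤ n) {S X : ℕ} (h : S ≤ n ^ X) :
    (Nat.clog 2 S : ℝ) ≤ X * (4 * Real.log n) := by
  have h1 : Nat.clog 2 S ≤ (Nat.log 2 n + 1) * X := by
    apply Nat.clog_le_of_le_pow
    rw [pow_mul]
    exact h.trans (Nat.pow_le_pow_left (Nat.lt_pow_succ_log_self one_lt_two n).le X)
  have h2 : (Nat.clog 2 S : ℝ) ≤ (Nat.log 2 n + 1) * X := by exact_mod_cast h1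
  have h3 := natLog_le hn
  have h4 := half_le_log hn
  rw [mul_comm] at h2
  refine h2.trans ?_
  gcongr
  linarith

theorem two_mul_pow_add_one_le (hn : 2 ≤ n) (k : ℕ) :
    (2 * (n ^ k : ℕ) + 1 : ℝ) ≤ (n : ℝ) ^ (k + 2) := by
  have hn' : (2 : ℝ) ≤ n := by exact_mod_cast hn
  have ha : (1 : ℝ) ≤ (n : ℝ) ^ k := one_le_pow₀ (by linarith)
  have h4 : (4 : ℝ) ≤ (n : ℝ) ^ 2 := by nlinarith
  push_cast
  rw [pow_add]
  nlinarith

theorem sample_size_bound (hn : 2 ≤ n) (a : ℕ) :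
    2 * ((2 * (n ^ (2 * a) : ℕ) + 1) ^ n * (n + 1) : ℝ)
      < Real.exp ((n : ℝ) ^ (2 * a + 10) / 4) := by
  have hn' : (2 : ℝ) ≤ n := by exact_mod_cast hn
  have hpos : (0 : ℝ) < n := by linarith
  have h1 : (2 * (n ^ (2 * a) : ℕ) + 1 : ℝ) ≤ Real.exp ((2 * a + 2) * n) := by
    refine (two_mul_pow_add_one_le hn (2 * a)).trans ?_
    have he : (n : ℝ) ≤ Real.exp n := by linarith [Real.add_one_le_exp (n : ℝ)]
    calc (n : ℝ) ^ (2 * a + 2) ≤ Real.exp n ^ (2 * a + 2) := by gcongr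
      _ = _ := by rw [← Real.exp_nat_mul]; push_cast; rfl
  have h2 : (n + 1 : ℝ) ≤ Real.exp n := Real.add_one_le_exp _
  have h3 : (2 : ℝ) < Real.exp n := by linarith
  have h4 : (2 * a + 2 : ℝ) ≤ (n : ℝ) ^ (2 * a + 2) := by
    have : 2 * a + 2 ≤ n ^ (2 * a + 2) :=
      (Nat.lt_two_pow_self).le.trans (Nat.pow_le_pow_left hn _)
    exact_mod_cast this
  have h5 : ((2 * a + 2) * n * n + 2 * n : ℝ) ≤ (n : ℝ) ^ (2 * a + 10) / 4 := by
    have hP : (1 : ℝ) ≤ (n : ℝ) ^ (2 * a + 2) := one_le_pow₀ (by linarith)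
    have h8 : (8 : ℝ) ≤ n ^ 6 := by
      calc (8 : ℝ) ≤ 2 ^ 6 := by norm_num
        _ ≤ _ := by gcongr
    have : (n : ℝ) ^ (2 * a + 10) = (n : ℝ) ^ (2 * a + 2) * (n * n) * n ^ 6 := by ring
    rw [this]
    have h9 : (2 * a + 2) * n * n ≤ (n : ℝ) ^ (2 * a + 2) * (n * n) := by
      rw [mul_assoc]; gcongr
    have h10 : (2 * n : ℝ) ≤ (n : ℝ) ^ (2 * a + 2) * (n * n) := by nlinarith
    have h11 : 0 ≤ (n : ℝ) ^ (2 * a + 2) * (n * n) := by positivity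
    nlinarith
  calc 2 * ((2 * (n ^ (2 * a) : ℕ) + 1) ^ n * (n + 1) : ℝ)
      ≤ 2 * (Real.exp ((2 * a + 2) * n) ^ n * Real.exp n) := by gcongr
    _ < Real.exp n * (Real.exp ((2 * a + 2) * n) ^ n * Real.exp n) := by
        gcongr
    _ = Real.exp ((2 * a + 2) * n * n + 2 * n) := by
        rw [← Real.exp_nat_mul, ← Real.exp_add, ← Real.exp_add]
        congr 1
        ring
    _ ≤ _ := Real.exp_le_exp.2 h5

end Numerics

/-! ### Choice of parameters and the main theorem -/

section Main

/-- A streaming algorithm with approximately uniform samples, in `O(log² n)` bits. -/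
theorem exists_sketchAlg (a : ℕ) (c : ℝ) :
    ∃ K : ℝ, 0 < K ∧ ∀ n : ℕ, 2 ≤ n → ∃ B : StreamAlg n (Option (Fin n × ℤ)),
      (∃ X : ℕ, Nat.card B.State ≤ n ^ X ∧ (X : ℝ) ≤ K * Real.log n) ∧
      ∃ ε : ℝ, 0 ≤ ε ∧ 600 * (n + 1) * ε * (n : ℝ) ^ a ≤ (n : ℝ) ^ (-c) ∧
        ∀ s : List (Fin n × ℤ), (∀ i, |freq s i| ≤ (n ^ (2 * a) : ℕ)) → freq s ≠ 0 →
          IsApproxUniform ε (freq s) (B.output s) := by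
  -- With ε = n^(-e), the terms of the exponent absorb n^c, the factor n^a bounding H/Q, and
  -- 600(n+1) ≤ n^12.
  set e := ⌈c⌉₊ + a + 12 with he
  refine ⟨2 * (2 * e + 2 * a + 10) + 320 * (e + 2 * a + 15), by positivity, fun n hn => ?_⟩
  have hn' : (2 : ℝ) ≤ n := by exact_mod_cast hn
  have hn0 : (0 : ℝ) < n := by linarith
  -- Bertrand's postulate: p is large enough for decoding errors below n^(-e), yet polynomial in n,
  -- so a counter takes O(log n) bits.
  obtain ⟨p, hp, hNp, hpN⟩ :=
    Nat.exists_prime_lt_and_le_two_mul (n ^ (e + 2 * a + 14)) (by positivity)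
  have : Fact p.Prime := ⟨hp⟩
  have : NeZero p := ⟨hp.ne_zero⟩
  have : NeZero (n ^ (2 * e + 2 * a + 10)) := ⟨by positivity⟩
  have hpow : ∀ k : ℕ, (2 : ℝ) ^ k ≤ (n : ℝ) ^ k := fun k => by gcongr
  have hV : 2 * n ^ (2 * a) < p := by
    refine lt_of_le_of_lt ?_ hNp
    calc 2 * n ^ (2 * a) ≤ n * n ^ (2 * a) := by gcongr
      _ = n ^ (2 * a + 1) := by ring
      _ ≤ _ := Nat.pow_le_pow_right (by omega) (by omega)
  have hpR : (n : ℝ) ^ (e + 2 * a + 14) ≤ p := by exact_mod_cast hNp.le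
  have hVb := two_mul_pow_add_one_le hn (2 * a)
  have hL : ((topLevel n : ℝ) + 1) ≤ (n : ℝ) ^ 3 := by
    have h1 : Nat.log 2 n ≤ n := Nat.log_le_self 2 n
    have h2 : (Nat.log 2 n : ℝ) ≤ n := by exact_mod_cast h1
    simp only [topLevel]
    push_cast
    nlinarith [mul_le_mul hn' hn' zero_le_two hn0.le]
  have h40 : (40 : ℝ) ≤ (n : ℝ) ^ 6 := le_trans (by norm_num) (hpow 6)
  have hpp : ((topLevel n + 1) * 40 * (n * (2 * (n ^ (2 * a) : ℕ) + 1)) : ℝ) / p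
      ≤ ((n : ℝ) ^ e)⁻¹ := by
    have hp0 : (0 : ℝ) < p := by exact_mod_cast hp.pos
    rw [div_le_iff₀ hp0, inv_mul_eq_div, le_div_iff₀ (by positivity)]
    calc _ ≤ (n : ℝ) ^ 3 * n ^ 6 * (n * n ^ (2 * a + 2)) * n ^ e := by gcongr
      _ = (n : ℝ) ^ (e + 2 * a + 12) := by ring
      _ ≤ (n : ℝ) ^ (e + 2 * a + 14) := pow_le_pow_right₀ (by linarith) (by omega)
      _ ≤ p := hpR
  -- With this `t`, ε²t = n^(2a+10), which beats the logarithm of the number of events.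
  obtain ⟨ω, hω⟩ := exists_seeds (n := n) (V := n ^ (2 * a)) (t := n ^ (2 * e + 2 * a + 10))
    (p := p) hV (ε := ((n : ℝ) ^ e)⁻¹) (by positivity)
    (inv_le_one_of_one_le₀ (one_le_pow₀ (by linarith)))
    (by
      refine (sample_size_bound hn a).trans_eq ?_
      congr 2
      push_cast
      field_simp
      ring) hpp
  refine ⟨sketchAlg (n ^ (2 * a)) ω,
    ⟨(2 * e + 2 * a + 10) + (e + 2 * a + 15) * ((topLevel n + 1) * 40), ?_, ?_⟩,
    ((n : ℝ) ^ e)⁻¹, by positivity, ?_, fun s hs hs0 => ?_⟩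
  · rw [card_sketchAlg_state, pow_add n (2 * e + 2 * a + 10), pow_mul n (e + 2 * a + 15)]
    gcongr
    refine hpN.trans ?_
    rw [pow_succ n (e + 2 * a + 14), mul_comm]
    gcongr
  · have h1 := natLog_le hn
    have h2 := half_le_log hn
    simp only [topLevel]
    push_cast
    have h3 : ((Nat.log 2 n : ℝ) + 2 + 1) * 40 ≤ 320 * Real.log n := by linarith
    have h4 : (e + 2 * a + 15 : ℝ) * (((Nat.log 2 n : ℝ) + 2 + 1) * 40)
        ≤ (e + 2 * a + 15) * (320 * Real.log n) := by gcongr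
    have h5 : (2 * e + 2 * a + 10 : ℝ) * 1 ≤ (2 * e + 2 * a + 10) * (2 * Real.log n) := by
      gcongr
      linarith
    linarith
  · have h1 : ((n : ℝ) ^ ⌈c⌉₊)⁻¹ ≤ (n : ℝ) ^ (-c) := by
      rw [Real.rpow_neg hn0.le, ← Real.rpow_natCast]
      gcongr
      · linarith
      · exact Nat.le_ceil c
    refine le_trans ?_ h1
    have h600 : (600 : ℝ) ≤ (n : ℝ) ^ 10 := le_trans (by norm_num) (hpow 10)
    have hn1 : (n + 1 : ℝ) ≤ (n : ℝ) ^ 2 := by nlinarith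
    rw [mul_right_comm, ← div_eq_mul_inv, div_le_iff₀ (by positivity), inv_mul_eq_div,
      le_div_iff₀ (by positivity)]
    calc _ ≤ (n : ℝ) ^ 10 * n ^ 2 * n ^ a * n ^ ⌈c⌉₊ := by gcongr
      _ = (n : ℝ) ^ e := by rw [he]; ring
  · rw [sketchAlg_output]
    exact hω _ hs hs0

theorem bits_rejectionSampler_le {n X : ℕ} (hn : 2 ≤ n) (B : StreamAlg n (Option (Fin n × ℤ)))
    (hX : Nat.card B.State ≤ n ^ X) (G : ℝ → ℝ) (H : ℝ) (R : ℕ) :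
    ((rejectionSampler B G H R).bits : ℝ) ≤ R * (X * (4 * Real.log n)) := by
  have h : Nat.card (rejectionSampler B G H R).State ≤ n ^ (X * R) := by
    change Nat.card (Fin R → B.State) ≤ _
    rw [Nat.card_fun, Nat.card_fin, pow_mul]
    exact Nat.pow_le_pow_left hX R
  refine (clog_le_of_le_pow hn h).trans_eq ?_
  push_cast
  ring

theorem bits_storeAlg_le {n m M a : ℕ} (hn : 2 ≤ n) (hm : m ≤ n ^ a) (hM : M ≤ n ^ a)
    {Out : Type} (q : List (Fin n × ℤ) → PMF Out) :
    ((storeAlg m M q).bits : ℝ) ≤ (n : ℝ) ^ a * ((a + 3) * (4 * Real.log n)) := by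
  have h1 : n * (2 * M + 1) + 1 ≤ n ^ (a + 3) := by
    have ha : 1 ≤ n ^ a := Nat.one_le_pow _ _ (by omega)
    have h4 : 4 ≤ n * n := Nat.mul_le_mul hn hn
    calc n * (2 * M + 1) + 1 ≤ n * (2 * n ^ a + n ^ a) + n * n ^ a := by
          gcongr
          exact one_le_mul (by omega) ha
      _ = 4 * (n ^ a * n) := by ring
      _ ≤ n * n * (n ^ a * n) := by gcongr
      _ = n ^ (a + 3) := by ring
  have h2 : Nat.card (storeAlg m M q).State ≤ n ^ ((a + 3) * n ^ a) := by
    refine (finite_turnstile n m M).2.trans ?_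
    rw [pow_mul]
    exact (Nat.pow_le_pow_left h1 m).trans
      (Nat.pow_le_pow_right (Nat.pow_pos (by omega)) hm)
  refine (clog_le_of_le_pow hn h2).trans_eq ?_
  push_cast
  ring

theorem mainTheorem8 (a : ℕ) (c : ℝ) (hc : 0 < c) :
    ∃ C : ℝ, 0 < C ∧ ∀ n m M : ℕ, 2 ≤ n → m ≤ n ^ a → M ≤ n ^ a →
      ∃ B : StreamAlg n (Option (Fin n × ℤ)),
        (B.bits : ℝ) ≤ C * Real.log n ^ 2 ∧
        (∀ s : List (Fin n × ℤ), IsTurnstileStream m M s → freq s ≠ 0 →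
          IsPerfectL0Sample (1 / 100) c (freq s) (B.output s)) ∧
        ∀ (G : ℝ → ℝ) (Q H : ℝ) (Z : Set ℤ),
          (∀ z, 0 ≤ G z) → G 0 = 0 → 0 < Q → Q ≤ H →
          (∀ z ∈ Z, Q ≤ G z ∧ G z ≤ H) →
          ∃ A : StreamAlg n (Option (Fin n)),
            (A.bits : ℝ) ≤ C * (H / Q) * Real.log n ^ 2 ∧
            (∀ s : List (Fin n × ℤ), IsTurnstileStream m M s → freq s ≠ 0 →
              (∀ i, freq s i ≠ 0 → freq s i ∈ Z) →
              IsPerfectSample G (1 / 100) c (freq s) (A.output s)) ∧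
            (H / Q ≤ (n : ℝ) ^ a →
              ∃ R : ℕ, (R : ℝ) ≤ C * (H / Q) ∧ A = rejectionSampler B G H R) := by
  classical
  obtain ⟨K, hK, hB⟩ := exists_sketchAlg a c
  -- The summands pay for the bits of rejection sampling, the bits of the stored stream, and the
  -- number of copies.
  refine ⟨44 * K + 8 * (a + 3) + 11, by positivity, fun n m M hn hm hM => ?_⟩
  obtain ⟨B, ⟨X, hX, hXK⟩, ε, hε0, hε, hBs⟩ := hB n hn
  have hn' : (2 : ℝ) ≤ n := by exact_mod_cast hn
  have hlog := half_le_log hn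
  have hfreq : ∀ s : List (Fin n × ℤ), IsTurnstileStream m M s →
      ∀ i, |freq s i| ≤ (n ^ (2 * a) : ℕ) := by
    intro s hs i
    refine (abs_freq_le hs i).trans ?_
    rw [two_mul, pow_add]
    exact_mod_cast Nat.mul_le_mul hm hM
  refine ⟨B, ?_, fun s hs hs0 => ?_, fun G Q H Z hG hG0 hQ hQH hZ => ?_⟩
  · refine (clog_le_of_le_pow hn hX).trans ?_
    calc X * (4 * Real.log n) ≤ K * Real.log n * (4 * Real.log n) := by gcongr
      _ = 4 * K * Real.log n ^ 2 := by ring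
      _ ≤ _ := by
        gcongr
        linarith [Nat.cast_nonneg (α := ℝ) a]
  · refine (hBs s (hfreq s hs) hs0).isPerfectL0Sample hn hc hε0 (le_trans ?_ hε)
    exact le_mul_of_one_le_right (by positivity) (one_le_pow₀ (by linarith))
  · have hHQ : 1 ≤ H / Q := (one_le_div hQ).2 hQH
    have ha0 : (0 : ℝ) ≤ a := Nat.cast_nonneg a
    by_cases hcase : H / Q ≤ (n : ℝ) ^ a
    · have hR1 : 10 * (H / Q) ≤ (⌈10 * (H / Q)⌉₊ : ℝ) := Nat.le_ceil _
      have hR2 : (⌈10 * (H / Q)⌉₊ : ℝ) ≤ 11 * (H / Q) := by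
        linarith [Nat.ceil_lt_add_one (show 0 ≤ 10 * (H / Q) by positivity)]
      refine ⟨rejectionSampler B G H ⌈10 * (H / Q)⌉₊, ?_, fun s hs hs0 hsZ => ?_, fun _ =>
        ⟨_, hR2.trans (by gcongr; linarith), rfl⟩⟩
      · refine (bits_rejectionSampler_le hn B hX G H _).trans ?_
        calc _ ≤ 11 * (H / Q) * (K * Real.log n * (4 * Real.log n)) := by gcongr
          _ = 44 * K * (H / Q) * Real.log n ^ 2 := by ring
          _ ≤ _ := by gcongr; linarith
      · rw [rejectionSampler_output]
        refine (hBs s (hfreq s hs) hs0).isPerfectSample_firstAcceptedLaw hn hc hε0 hG hG0 hQ hQH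
          (fun i hi => hZ _ (hsZ i hi)) (le_trans ?_ hε) hR1
        gcongr
    · push Not at hcase
      -- The default `none` does not matter: a nonzero vector with nonzero entries in `Z` has
      -- positive total mass.
      let q : List (Fin n × ℤ) → PMF (Option (Fin n)) := fun s =>
        if h : 0 < ∑ i, G (freq s i) then
          (exists_isPerfectSample (c := c) hG (show (0 : ℝ) ≤ 1 / 100 by norm_num) _ h).choose
        else PMF.pure none
      refine ⟨storeAlg m M q, ?_, fun s hs hs0 hsZ => ?_, fun h => absurd h (not_le.2 hcase)⟩
      · refine (bits_storeAlg_le hn hm hM q).trans ?_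
        -- Here n^a < H/Q, and 1 ≤ 2 log n supplies the second logarithm.
        calc _ ≤ H / Q * ((a + 3) * (4 * (Real.log n * (2 * Real.log n)))) := by
              gcongr
              exact le_mul_of_one_le_right (by linarith) (by linarith)
          _ = 8 * (a + 3) * (H / Q) * Real.log n ^ 2 := by ring
          _ ≤ _ := by gcongr; linarith
      · rw [storeAlg_output m M q s hs]
        have hpos : 0 < ∑ i, G (freq s i) := by
          obtain ⟨i, hi⟩ := Function.ne_iff.1 hs0
          exact Finset.sum_pos' (fun j _ => hG _)
            ⟨i, Finset.mem_univ i, hQ.trans_le (hZ _ (hsZ i hi)).1⟩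
        simp only [q, dif_pos hpos]
        exact (exists_isPerfectSample hG (by norm_num) _ hpos).choose_spec

end Main
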